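/- **The model.** Let $N$ be even, let $V$ be a set of $N$ vertices, and let $P_1,P_2$ be a partition of $V$ with $|P_1|=|P_2|=N/2$. For $0\le q,p\le 1$, the $p,q$-stochastic block model is the distribution of a random graph $G$ on $V$ whose edges are independent, where the pair $\{i,j\}$, $i\ne j$, is an edge with probability $p$ if $i,j$ lie in the same $P_s$ and with probability $q$ otherwise. **One iteration of DER with $L=1$.** Let $A=(a_{ij})$ be the adjacency matrix of $G$ and $d_i=\sum_j a_{ij}$. Let $w_i$ be the distribution of one step of the random walk on $G$ from $i$, i.e. $w_i(j)=a_{ij}/d_i$. For $S\subseteq V$ let $d_S=\sum_{i\in S}d_i$ and $\mu_S=\frac1{d_S}\sum_{i\in S}d_iw_i$, and set $D(\nu,\mu)=\sum_{i\in V}\nu(i)\log\mu(i)$ (with $\log 0=-\infty$, $0\cdot(-\infty)=0$). Given a partition $C_1,C_2$ of $V$, one iteration produces the sets $$C_s'=\{\,i\in V : s=\operatorname{argmax}_{l\in\{1,2\}} D(w_i,\mu_{C_l})\,\},\qquad s=1,2,$$ where the argmax is required to be the unique maximizer. The iteration *recovers* $P_1,P_2$ if $(C_1',C_2')$ equals $(P_1,P_2)$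 or $(P_2,P_1)$; in particular no vertex is then tied. **Theorem 5.1.** For every $\varepsilon>0$ there exist constants $C>0$ and $c>0$ and a function $\phi:\mathbb N\to\mathbb R$ with $\phi(N)\to1$ as $N\to\infty$, depending only on $\varepsilon$, such that the following holds for every even $N$, every partition $P_1,P_2$ of the $N$ vertices with $|P_1|=|P_2|$, and all $p,q\in[0,1]$ with $$p\ \ge\ C\,N^{-\frac12+\varepsilon}\qquad\text{and}\qquad p-q\ \ge\ c\,\sqrt{p\,N^{-\frac12+\varepsilon}\,\log N}.$$ Let $G$ be drawn from the $p,q$-stochastic block model with blocks $P_1,P_2$ and, independently of $G$, let $C_1,C_2$ be a uniformly random partition of $V$ into two sets of size $N/2$. Then, with probability at least $\phi(N)$ over the joint draw of $G$ and $(C_1,C_2)$, one iteration of DER with $L=1$ started from $C_1,C_2$ recovers $P_1,P_2$. -/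

import Mathlib

open Filter Topology MeasureTheory ProbabilityTheory
open scoped Classical

noncomputable section

/-! ### The stochastic block model -/

/-- The probability that the pair `e` is an edge: `p` if both endpoints of `e` lie in the same
block of the partition given by the labelling `P`, and `q` otherwise. -/
def edgeProb {V : Type*} {k : ℕ} (P : V → Fin k) (p q : unitInterval) (e : Sym2 V) : unitInterval :=
  if (Sym2.map P e).IsDiag then p else q

/-- The `p,q`-stochastic block model with block labelling `P`: the law of the random simple graph on
`V` in which all edges are independent and the edge `e` is present with probability
`edgeProb P p q e`. One independent coin is tossed for every unordered pair of vertices;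
`SimpleGraph.fromEdgeSet` ignores the coins of the degenerate pairs `s(v, v)`. -/
def stochasticBlockModel {V : Type*} [Fintype V] {k : ℕ} (P : V → Fin k) (p q : unitInterval) :
    Measure (SimpleGraph V) :=
  (Measure.pi fun e : Sym2 V ↦ bernoulliMeasure true false (edgeProb P p q e)).map
    fun x ↦ SimpleGraph.fromEdgeSet {e | x e = true}

/-- The labellings of `V` by `Fin k` all of whose cells have the same size `|V| / k`
(an exact quotient: there are no such labellings if `k` does not divide `|V|`). -/
def balancedLabellings (V : Type*) [Fintype V] (k : ℕ) : Set (V → Fin k) :=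
  {σ | ∀ s, k * (Finset.univ.filter fun i ↦ σ i = s).card = Fintype.card V}

/-- The cells of the partition given by a labelling. -/
def cells {V : Type*} [Fintype V] {k : ℕ} (σ : V → Fin k) (s : Fin k) : Finset V :=
  Finset.univ.filter fun i ↦ σ i = s

/-! ### The DER algorithm

`A` is the symmetric adjacency matrix of a (possibly weighted) graph on `V`. -/

namespace DER

variable {V : Type*} [Fintype V]

/-- The degree `d_i`. -/
def degree (A : Matrix V V ℝ) (i : V) : ℝ := ∑ j, A i j

/-- The transition matrix `T = D⁻¹ A` of the random walk (the row of a vertex of degree zero, from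
which no walk is defined, is set to zero). -/
def transition (A : Matrix V V ℝ) : Matrix V V ℝ := Matrix.of fun i j ↦ A i j / degree A i

/-- The measure `w_i = (1 / L) (w_i^1 + ⋯ + w_i^L)`, with `w_i^t` the `i`-th row of `T ^ t`. -/
def walk (A : Matrix V V ℝ) (L : ℕ) (i : V) : V → ℝ :=
  fun j ↦ (1 / (L : ℝ)) * ∑ t ∈ Finset.Icc 1 L, (transition A ^ t) i j

/-- The measure `μ_S = (1 / d_S) ∑_{i ∈ S} d_i w_i`, with `d_S = ∑_{i ∈ S} d_i`. -/
def mean (A : Matrix V V ℝ) (L : ℕ) (S : Finset V) : V → ℝ :=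
  fun j ↦ (1 / ∑ i ∈ S, degree A i) * ∑ i ∈ S, degree A i * walk A L i j

/-- `D(ν, μ) = ∑ i, ν(i) log μ(i)`, an extended real number: `log 0 = -∞` and `0 · (-∞) = 0`. -/
def logLik (ν μ : V → ℝ) : EReal := ∑ i, (ν i : EReal) * ENNReal.log (ENNReal.ofReal (μ i))

/-- One iteration of DER with walk length `L`: the means `μ_s` of the current cells `C s` are
computed, and the new cell `s` consists of the vertices `i` for which `s` is the argmax over `l` of
`D(w_i, μ_l)`. Here the argmax is the unique maximizer: a vertex at which the maximum is attained
twice is in no new cell. -/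
def step (A : Matrix V V ℝ) (L : ℕ) {k : ℕ} (C : Fin k → Finset V) (s : Fin k) : Finset V :=
  Finset.univ.filter fun i ↦ ∀ l, l ≠ s →
    logLik (walk A L i) (mean A L (C l)) < logLik (walk A L i) (mean A L (C s))

/-- The cells `C` form the partition of the labelling `P`, up to the order of the cells. -/
def Recovers {k : ℕ} (C : Fin k → Finset V) (P : V → Fin k) : Prop :=
  ∃ τ : Equiv.Perm (Fin k), ∀ s, C s = cells P (τ s)

end DER

end

noncomputable section

/-! ### A Bernstein inequality for Bernoulli sums with partially random coefficients -/

/-! Let `s` and `u` be the sign vectors of the starting partition and of the true blocks, and `D = ∑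
s_k u_k` their overlap. For one iteration with `L = 1`, the likelihood difference at a vertex `i`,
multiplied by `d_i`, is `score A s i`. It compares the logarithms of the degrees `x_j`, `y_j` of the
neighbours `j` of `i` into the two starting cells, up to a normalisation common to all vertices.

All `x_j` and `y_j` lie near `m = (p+q)N/4`, so the logarithm can be linearised there. As `x_j - y_j
= ∑_k s_k A_jk`, the linear part is `1/m` times a signed count of paths of length two from `i`. Its
main term has sign `u_i · sign D` and size at least `(p-q)²|D|N/8`: one factor `p-q` comes from the
drift `(p-q)u_j D/2` of `x_j - y_j`, the other from the excess of neighbours of `i` in its own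
block.

On the same scale, the fluctuation of the path count, the quadratic remainder of the logarithm and
the normalisation term are each `O(pN log N)`, apart from a part of the remainder of order
`((p-q)D)²`, which the signal dominates when `|D| ≤ N/100`. So every vertex is classified correctly
as soon as `(p-q)²|D|` exceeds a large multiple of `p log N` (`score_pos`). The path count is
controlled by revealing the edges at `i` first: given these, it is linear in the remaining
independent coins, and a Bernstein bound with partially random coefficients applies
(`measureReal_coins_abs`, `measureReal_paths_le`).

The overlap of a random balanced partition has no atom heavier than order `N^(-1/2)`, so `|D| ≥
N^(1/2-ε/2)` with high probability (`card_small_overlap_le`); a second moment bound gives `|D| ≤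
N/100` (`card_large_overlap_le`). The assumed gap then yields `(p-q)²|D| ≥ p N^(ε/2) log N`, and the
factor `N^(ε/2)` absorbs all constants. Fubini combines the two sources of randomness. -/

/-- The value `0` or `1` of a coin. -/
def coin (b : Bool) : ℝ := if b then 1 else 0

/-- The inequality `exp t ≤ 1 + t + t²` on `[-1, 1]` bounds the moment generating function of a
centred coin by `exp (t² p)`. -/
lemma integral_exp_coin_le_one (p : unitInterval) {t : ℝ} (ht : |t| ≤ 1) :
    ∫ b, Real.exp (t * (coin b - p) - t ^ 2 * p) ∂(bernoulliMeasure true false p) ≤ 1 := by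
  have hp0 : (0 : ℝ) ≤ p := p.2.1
  have hexp : Real.exp t ≤ 1 + t + t ^ 2 := by
    have := (abs_le.1 (Real.abs_exp_sub_one_sub_id_le ht)).2
    linarith
  rw [integral_bernoulliMeasure]
  simp only [coin, smul_eq_mul, if_true, Bool.false_eq_true, if_false]
  have h1 : Real.exp (t * (1 - (p : ℝ)) - t ^ 2 * p)
      = Real.exp (-(t * p) - t ^ 2 * p) * Real.exp t := by
    rw [← Real.exp_add]; ring_nf
  have h2 : Real.exp (t * (0 - (p : ℝ)) - t ^ 2 * p) = Real.exp (-(t * p) - t ^ 2 * p) := by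
    ring_nf
  rw [h1, h2]
  have h3 : (p : ℝ) * Real.exp t + (1 - p) ≤ Real.exp (t * p + t ^ 2 * p) := by
    have := Real.add_one_le_exp (t * (p : ℝ) + t ^ 2 * p)
    nlinarith [mul_le_mul_of_nonneg_left hexp hp0]
  calc _ = Real.exp (-(t * p) - t ^ 2 * p) * ((p : ℝ) * Real.exp t + (1 - p)) := by ring
    _ ≤ Real.exp (-(t * p) - t ^ 2 * p) * Real.exp (t * p + t ^ 2 * p) := by gcongr
    _ = 1 := by rw [← Real.exp_add]; simp

section Coins

variable {ι : Type*} [Fintype ι]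

/-- Conditioning on the coins in `S` freezes the coefficients. They vanish on `S`, so the remaining
integral factorises over the coins outside `S`. -/
lemma integral_exp_coins_le_one (P : ι → unitInterval) (S : Set ι) (c : (ι → Bool) → ι → ℝ)
    (hc : ∀ x y, (∀ e ∈ S, x e = y e) → c x = c y) (hS : ∀ x, ∀ e ∈ S, c x e = 0)
    (hb : ∀ x e, |c x e| ≤ 1) :
    ∫ x, Real.exp (∑ e, (c x e * (coin (x e) - P e) - c x e ^ 2 * P e))
      ∂(Measure.pi fun e ↦ bernoulliMeasure true false (P e)) ≤ 1 := by
  have hmp := (measurePreserving_piEquivPiSubtypeProd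
    (fun e ↦ bernoulliMeasure true false (P e)) (· ∈ S)).symm
  rw [← hmp.integral_comp', integral_prod _ Integrable.of_finite]
  set E := (MeasurableEquiv.piEquivPiSubtypeProd (fun _ : ι ↦ Bool) (· ∈ S)).symm
  have hE1 : ∀ a b (e : ι) (he : e ∈ S), E (a, b) e = a ⟨e, he⟩ := by
    intro a b e he
    simp [E, MeasurableEquiv.piEquivPiSubtypeProd, Equiv.piEquivPiSubtypeProd, he]
  have hE2 : ∀ a b (e : ι) (he : e ∉ S), E (a, b) e = b ⟨e, he⟩ := by
    intro a b e he
    simp [E, MeasurableEquiv.piEquivPiSubtypeProd, Equiv.piEquivPiSubtypeProd, he]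
  have key : ∀ a, ∫ b, Real.exp (∑ e, (c (E (a, b)) e * (coin (E (a, b) e) - P e)
      - c (E (a, b)) e ^ 2 * P e))
      ∂(Measure.pi fun e : {e // e ∉ S} ↦ bernoulliMeasure true false (P e)) ≤ 1 := by
    intro a
    set c0 := c (E (a, fun _ ↦ false)) with hc0
    have hcc : ∀ b, c (E (a, b)) = c0 := fun b ↦
      hc _ _ fun e he ↦ by rw [hE1 _ _ _ he, hE1 _ _ _ he]
    have : ∀ b, Real.exp (∑ e, (c (E (a, b)) e * (coin (E (a, b) e) - P e)
        - c (E (a, b)) e ^ 2 * P e))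
        = ∏ e : {e // e ∉ S}, Real.exp (c0 e * (coin (b e) - P e) - c0 e ^ 2 * P e) := by
      intro b
      rw [← Real.exp_sum, hcc]
      congr 1
      have h1 : ∀ e : {e // e ∉ S}, c0 e * (coin (b e) - P e) - c0 e ^ 2 * P e
          = c0 e * (coin (E (a, b) e) - P e) - c0 e ^ 2 * P e := fun e ↦ by rw [hE2 _ _ _ e.2]
      rw [Finset.sum_congr rfl fun e _ ↦ h1 e,
        ← Finset.sum_subtype (Finset.univ.filter (· ∉ S)) (p := (· ∉ S)) (by simp)
          (fun e ↦ c0 e * (coin (E (a, b) e) - P e) - c0 e ^ 2 * P e), Finset.sum_filter]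
      refine Finset.sum_congr rfl fun e _ ↦ ?_
      split_ifs with h
      · have : c0 e = 0 := hS _ _ h
        simp [this]
      · rfl
    simp_rw [this]
    rw [integral_fintype_prod_eq_prod
      (fun (e : {e // e ∉ S}) (z : Bool) ↦ Real.exp (c0 e * (coin z - P e) - c0 e ^ 2 * P e))]
    refine Finset.prod_le_one (fun e _ ↦ integral_nonneg fun _ ↦ (Real.exp_pos _).le) fun e _ ↦ ?_
    exact integral_exp_coin_le_one _ (hb _ _)
  calc _ ≤ ∫ _a, (1 : ℝ) ∂(Measure.pi fun e : {e // e ∈ S} ↦ bernoulliMeasure true false (P e)) :=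
        integral_mono Integrable.of_finite Integrable.of_finite key
    _ = 1 := by simp

/-- Chernoff's method with `l` fixed in advance: the variance proxy is itself random, so it stays
inside the event and `l` cannot be optimised against it. -/
lemma measureReal_coins_upper (P : ι → unitInterval) (S : Set ι) (c : (ι → Bool) → ι → ℝ)
    (hc : ∀ x y, (∀ e ∈ S, x e = y e) → c x = c y) (hS : ∀ x, ∀ e ∈ S, c x e = 0)
    {l s : ℝ} (hl : 0 < l) (hb : ∀ x e, |l * c x e| ≤ 1) :
    (Measure.pi fun e ↦ bernoulliMeasure true false (P e)).real
      {x | l * ∑ e, c x e ^ 2 * P e + s / l < ∑ e, c x e * (coin (x e) - P e)} ≤ Real.exp (-s) := by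
  set μ := Measure.pi fun e ↦ bernoulliMeasure true false (P e)
  have h1 := integral_exp_coins_le_one P S (fun x e ↦ l * c x e)
    (fun x y h ↦ by simp [hc x y h]) (fun x e h ↦ by simp [hS x e h]) hb
  have h2 := mul_meas_ge_le_integral_of_nonneg (μ := μ)
    (f := fun x ↦ Real.exp (∑ e, (l * c x e * (coin (x e) - P e) - (l * c x e) ^ 2 * P e)))
    (Eventually.of_forall fun x ↦ (Real.exp_pos _).le) Integrable.of_finite (Real.exp s)
  have h3 : μ.real {x | l * ∑ e, c x e ^ 2 * P e + s / l < ∑ e, c x e * (coin (x e) - P e)}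
      ≤ μ.real {x | Real.exp s ≤
        Real.exp (∑ e, (l * c x e * (coin (x e) - P e) - (l * c x e) ^ 2 * P e))} := by
    refine measureReal_mono fun x hx ↦ ?_
    simp only [Set.mem_ofPred_eq, Real.exp_le_exp] at hx ⊢
    have := mul_le_mul_of_nonneg_left hx.le hl.le
    rw [mul_add, mul_div_cancel₀ _ hl.ne'] at this
    have e1 : ∑ e, (l * c x e * (coin (x e) - P e) - (l * c x e) ^ 2 * P e)
        = l * ∑ e, c x e * (coin (x e) - P e) - l * (l * ∑ e, c x e ^ 2 * P e) := by
      simp only [Finset.mul_sum, ← Finset.sum_sub_distrib]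
      exact Finset.sum_congr rfl fun e _ ↦ by ring
    rw [e1]; linarith
  rw [Real.exp_neg, ← one_div, le_div_iff₀ (Real.exp_pos s)]
  nlinarith [Real.exp_pos s]

lemma measureReal_coins_abs (P : ι → unitInterval) (S : Set ι) (c : (ι → Bool) → ι → ℝ)
    (hc : ∀ x y, (∀ e ∈ S, x e = y e) → c x = c y) (hS : ∀ x, ∀ e ∈ S, c x e = 0)
    {l s : ℝ} (hl : 0 < l) (hb : ∀ x e, |l * c x e| ≤ 1) :
    (Measure.pi fun e ↦ bernoulliMeasure true false (P e)).real
      {x | l * ∑ e, c x e ^ 2 * P e + s / l < |∑ e, c x e * (coin (x e) - P e)|}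
      ≤ 2 * Real.exp (-s) := by
  have h1 := measureReal_coins_upper P S c hc hS (s := s) hl hb
  have h2 := measureReal_coins_upper P S (fun x ↦ -c x) (fun x y h ↦ by simp [hc x y h])
    (fun x e h ↦ by simp [hS x e h]) (s := s) hl (fun x e ↦ by simpa using hb x e)
  refine (measureReal_mono (fun x hx ↦ ?_)).trans ((measureReal_union_le _ _).trans
    (add_le_add h1 h2 |>.trans_eq (two_mul _).symm))
  simp only [Set.mem_ofPred_eq, lt_abs, Pi.neg_apply, neg_mul, Finset.sum_neg_distrib, even_two,
    Even.neg_pow, Set.mem_union] at hx ⊢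
  exact hx

end Coins

/-! ### Linear statistics of an inhomogeneous random graph -/

section Graph

variable {V : Type*}

/-- The adjacency matrix of the graph given by the coins `x`. -/
def coinMatrix (x : Sym2 V → Bool) : Matrix V V ℝ :=
  (SimpleGraph.fromEdgeSet {e | x e = true}).adjMatrix ℝ

/-- The expected adjacency matrix of the random graph with edge probabilities `Q`. -/
def meanMatrix (Q : Sym2 V → unitInterval) : Matrix V V ℝ :=
  fun j k ↦ if j = k then 0 else Q s(j, k)

lemma coinMatrix_apply (x : Sym2 V → Bool) (j k : V) :
    coinMatrix x j k = if j = k then 0 else coin (x s(j, k)) := by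
  simp only [coinMatrix, SimpleGraph.adjMatrix_apply, SimpleGraph.fromEdgeSet_adj, coin]
  by_cases h : j = k <;> simp [h]

variable [Fintype V]

lemma card_sym2_fiber_le (e : Sym2 V) :
    (Finset.univ.filter fun jk : V × V ↦ s(jk.1, jk.2) = e).card ≤ 2 := by
  induction e with
  | _ a b =>
    refine (Finset.card_le_card (t := {(a, b), (b, a)}) ?_).trans Finset.card_le_two
    intro jk h
    simp only [Finset.mem_filter, Finset.mem_univ, true_and, Sym2.eq_iff] at h
    simpa [Prod.ext_iff] using h

/-- A matrix statistic sees each off-diagonal coin twice, as `(j, k)` and `(k, j)`. Merging the two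
coefficients doubles the sup bound, hence `l ≤ 1/2`, and costs a factor 2 in the variance by
Cauchy–Schwarz. -/
lemma measureReal_graph_abs (Q : Sym2 V → unitInterval) {r : ℝ} (hQ : ∀ e, (Q e : ℝ) ≤ r)
    (S : Set (Sym2 V)) (b : (Sym2 V → Bool) → V → V → ℝ)
    (hb : ∀ x y, (∀ e ∈ S, x e = y e) → b x = b y)
    (hS : ∀ x j k, s(j, k) ∈ S → b x j k = 0) (hb1 : ∀ x j k, |b x j k| ≤ 1)
    {l s : ℝ} (hl : 0 < l) (hl2 : l ≤ 1 / 2) :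
    (Measure.pi fun e ↦ bernoulliMeasure true false (Q e)).real
      {x | 2 * l * r * ∑ j, ∑ k, b x j k ^ 2 + s / l
        < |∑ j, ∑ k, b x j k * (coinMatrix x j k - meanMatrix Q j k)|} ≤ 2 * Real.exp (-s) := by
  -- Diagonal pairs carry coins that the graph ignores, so their coefficients are removed.
  let b' : (Sym2 V → Bool) → V × V → ℝ := fun x jk ↦ if jk.1 = jk.2 then 0 else b x jk.1 jk.2
  let F : Sym2 V → Finset (V × V) := fun e ↦ Finset.univ.filter fun jk ↦ s(jk.1, jk.2) = e
  let c : (Sym2 V → Bool) → Sym2 V → ℝ := fun x e ↦ ∑ jk ∈ F e, b' x jk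
  have hb'1 : ∀ x jk, |b' x jk| ≤ 1 := by
    intro x jk
    simp only [b']
    split_ifs
    · simp
    · exact hb1 _ _ _
  have hc2 : ∀ x e, |c x e| ≤ 2 := by
    intro x e
    calc |c x e| ≤ ∑ jk ∈ F e, |b' x jk| := Finset.abs_sum_le_sum_abs _ _
      _ ≤ ∑ jk ∈ F e, (1 : ℝ) := Finset.sum_le_sum fun jk _ ↦ hb'1 x jk
      _ = ((F e).card : ℝ) := by simp
      _ ≤ 2 := by exact_mod_cast card_sym2_fiber_le e
  have hsq : ∀ x e, c x e ^ 2 ≤ 2 * ∑ jk ∈ F e, b' x jk ^ 2 := by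
    intro x e
    refine (sq_sum_le_card_mul_sum_sq (s := F e) (f := b' x)).trans ?_
    have : ((F e).card : ℝ) ≤ 2 := by exact_mod_cast card_sym2_fiber_le e
    have h0 : 0 ≤ ∑ jk ∈ F e, b' x jk ^ 2 := Finset.sum_nonneg fun _ _ ↦ sq_nonneg _
    nlinarith
  have hfib : ∀ f : V × V → ℝ, ∑ e, ∑ jk ∈ F e, f jk = ∑ j, ∑ k, f (j, k) := by
    intro f
    rw [← Fintype.sum_prod_type]
    exact Finset.sum_fiberwise _ _ _
  have hlin : ∀ x, ∑ e, c x e * (coin (x e) - Q e)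
      = ∑ j, ∑ k, b x j k * (coinMatrix x j k - meanMatrix Q j k) := by
    intro x
    have : ∀ e, c x e * (coin (x e) - Q e) = ∑ jk ∈ F e,
        b x jk.1 jk.2 * (coinMatrix x jk.1 jk.2 - meanMatrix Q jk.1 jk.2) := by
      intro e
      rw [Finset.sum_mul]
      refine Finset.sum_congr rfl fun jk h ↦ ?_
      have h : s(jk.1, jk.2) = e := (Finset.mem_filter.1 h).2
      simp only [b', coinMatrix_apply, meanMatrix, h]
      split_ifs <;> simp
    rw [Finset.sum_congr rfl fun e _ ↦ this e, hfib]
  have hr : 0 ≤ r ∨ IsEmpty V := by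
    rcases isEmpty_or_nonempty V with h | ⟨⟨v⟩⟩
    · exact .inr h
    · exact .inl ((Q s(v, v)).2.1.trans (hQ _))
  have hV : ∀ x, ∑ e, c x e ^ 2 * Q e ≤ 2 * r * ∑ j, ∑ k, b x j k ^ 2 := by
    intro x
    rcases hr with hr | hr
    swap
    · have : IsEmpty (Sym2 V) := ⟨fun e ↦ e.ind fun a _ ↦ hr.elim a⟩
      simp
    calc ∑ e, c x e ^ 2 * Q e ≤ ∑ e, 2 * r * ∑ jk ∈ F e, b' x jk ^ 2 := by
          refine Finset.sum_le_sum fun e _ ↦ ?_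
          have h0 : 0 ≤ ∑ jk ∈ F e, b' x jk ^ 2 := Finset.sum_nonneg fun _ _ ↦ sq_nonneg _
          calc c x e ^ 2 * Q e ≤ (2 * ∑ jk ∈ F e, b' x jk ^ 2) * r :=
                mul_le_mul (hsq x e) (hQ e) (Q e).2.1 (by positivity)
            _ = _ := by ring
      _ = 2 * r * ∑ j, ∑ k, b' x (j, k) ^ 2 := by
          rw [← Finset.mul_sum, hfib (fun jk ↦ b' x jk ^ 2)]
      _ ≤ _ := by
          refine mul_le_mul_of_nonneg_left (Finset.sum_le_sum fun j _ ↦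
            Finset.sum_le_sum fun k _ ↦ ?_) (by positivity)
          simp only [b']
          split_ifs
          · simp [sq_nonneg]
          · exact le_rfl
  refine (measureReal_mono fun x hx ↦ ?_).trans (measureReal_coins_abs Q S c ?_ ?_ hl (s := s) ?_)
  · simp only [Set.mem_ofPred_eq, hlin] at hx ⊢
    refine lt_of_le_of_lt ?_ hx
    nlinarith [mul_le_mul_of_nonneg_left (hV x) hl.le]
  · intro x y h
    simp only [c, b', hb x y h]
  · intro x e he
    refine Finset.sum_eq_zero fun jk h ↦ ?_
    have h : s(jk.1, jk.2) = e := (Finset.mem_filter.1 h).2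
    simp only [b']
    split_ifs
    · rfl
    · exact hS _ _ _ (h ▸ he)
  · intro x e
    rw [abs_mul, abs_of_pos hl]
    nlinarith [hc2 x e, abs_nonneg (c x e)]

/-- The deviations of the adjacency matrix `A` from the mean matrix `M` that one iteration of DER is
sensitive to, when run from the partition with signs `s` on a model whose blocks have signs `u`:
signed degrees, signed counts of paths of length two, and the total signed degree. -/
structure IsTypical (A M : Matrix V V ℝ) (s u : V → ℝ) (r L : ℝ) : Prop where
  row_one : ∀ i, |∑ k, (A i k - M i k)| ≤ 5 * √(r * Fintype.card V * L)
  row_init : ∀ i, |∑ k, s k * (A i k - M i k)| ≤ 5 * √(r * Fintype.card V * L)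
  row_block : ∀ i, |∑ k, u k * (A i k - M i k)| ≤ 5 * √(r * Fintype.card V * L)
  paths : ∀ i, |∑ j, ∑ k, (if j = i ∨ k = i then 0 else A i j * s k) * (A j k - M j k)|
    ≤ 2 * ∑ j, A i j + 3 * L * (r * Fintype.card V)
  total : |∑ j, ∑ k, s k * (A j k - M j k)| ≤ 5 * L * Fintype.card V

lemma measureReal_row_le (Q : Sym2 V → unitInterval) {r L : ℝ} (hQ : ∀ e, (Q e : ℝ) ≤ r)
    (s : V → ℝ) (hs : ∀ k, |s k| ≤ 1) (hL : 1 ≤ L) (hr : 4 * L ≤ r * Fintype.card V) (i : V) :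
    (Measure.pi fun e ↦ bernoulliMeasure true false (Q e)).real
      {x | 5 * √(r * Fintype.card V * L) < |∑ k, s k * (coinMatrix x i k - meanMatrix Q i k)|}
      ≤ 2 * Real.exp (-(3 * L)) := by
  set N : ℝ := (Fintype.card V : ℝ) with hN
  have hrN : 0 < r * N := by linarith
  have hr0 : 0 ≤ r := (Q s(i, i)).2.1.trans (hQ _)
  have h1 : √L * √L = L := Real.mul_self_sqrt (by linarith)
  have h2 : √(r * N) * √(r * N) = r * N := Real.mul_self_sqrt hrN.le
  have hL0 : 0 < √L := Real.sqrt_pos.2 (by linarith)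
  have hN0 : 0 < √(r * N) := Real.sqrt_pos.2 hrN
  have h4 : 2 * √L ≤ √(r * N) := Real.le_sqrt_of_sq_le (by nlinarith)
  refine (measureReal_mono fun x hx ↦ ?_).trans (measureReal_graph_abs Q hQ ∅
    (fun _ j k ↦ if j = i then s k else 0) (fun _ _ _ ↦ rfl) (by simp) ?_
    -- This `l` turns the two terms of the threshold into `2√(rNL)` and `3√(rNL)`, and `l ≤ 1/2`
    -- amounts to `4L ≤ rN`. With `L = log N`, the choice `s = 3L` makes each failure probability
    -- `O(N⁻³)`, which survives a union bound over the vertices.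
    (l := √L / √(r * N)) (s := 3 * L) (by positivity) ?_)
  · simp only [Set.mem_ofPred_eq] at hx ⊢
    have e1 : ∑ j, ∑ k, (if j = i then s k else 0) * (coinMatrix x j k - meanMatrix Q j k)
        = ∑ k, s k * (coinMatrix x i k - meanMatrix Q i k) := by
      rw [Finset.sum_eq_single i]
      · simp
      · intro j _ h; simp [h]
      · simp
    have e2 : ∑ j, ∑ k, (if j = i then s k else 0) ^ 2 ≤ N := by
      rw [Finset.sum_eq_single i]
      · calc _ ≤ ∑ _k : V, (1 : ℝ) := Finset.sum_le_sum fun k _ ↦ by simpa using hs k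
          _ = N := by simp [hN]
      · intro j _ h; simp [h]
      · simp
    rw [e1]
    refine lt_of_le_of_lt ?_ hx
    rw [Real.sqrt_mul hrN.le]
    have e3 : 2 * (√L / √(r * N)) * r * N = 2 * √L * √(r * N) := by
      field_simp; nlinarith
    have e4 : 3 * L / (√L / √(r * N)) = 3 * √L * √(r * N) := by
      field_simp; nlinarith
    calc _ ≤ 2 * (√L / √(r * N)) * r * N + 3 * L / (√L / √(r * N)) := by gcongr
      _ = _ := by rw [e3, e4]; ring
  · intro _ j k
    split_ifs
    · exact hs k
    · simp
  · rw [div_le_iff₀ hN0]; linarith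

lemma measureReal_total_le (Q : Sym2 V → unitInterval) {r L : ℝ} (hQ : ∀ e, (Q e : ℝ) ≤ r)
    (s : V → ℝ) (hs : ∀ k, |s k| ≤ 1) (hL : 1 ≤ L) (hr : r ≤ 1) (hN2 : 2 ≤ Fintype.card V) :
    (Measure.pi fun e ↦ bernoulliMeasure true false (Q e)).real
      {x | 5 * L * Fintype.card V < |∑ j, ∑ k, s k * (coinMatrix x j k - meanMatrix Q j k)|}
      ≤ 2 * Real.exp (-(3 * L)) := by
  set N : ℝ := (Fintype.card V : ℝ) with hN
  have hN2 : (2 : ℝ) ≤ N := by rw [hN]; exact_mod_cast hN2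
  refine (measureReal_mono fun x hx ↦ ?_).trans (measureReal_graph_abs Q (fun e ↦ (hQ e).trans hr) ∅
    (fun _ _ k ↦ s k) (fun _ _ _ ↦ rfl) (by simp) (fun _ _ k ↦ hs k)
    -- The trivial bound 1 on the edge probabilities suffices here: a deviation of order `LN` is
    -- harmless, since the total degree of a cell is of order `pN²`.
    (l := 1 / N) (s := 3 * L) (by positivity) ?_)
  · simp only [Set.mem_ofPred_eq] at hx ⊢
    refine lt_of_le_of_lt ?_ hx
    have e2 : ∑ _j : V, ∑ k, s k ^ 2 ≤ N * N := by
      calc _ ≤ ∑ _j : V, ∑ _k : V, (1 : ℝ) :=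
            Finset.sum_le_sum fun _ _ ↦ Finset.sum_le_sum fun k _ ↦ by simpa using hs k
        _ = N * N := by simp [hN]
    calc _ ≤ 2 * (1 / N) * 1 * (N * N) + 3 * L / (1 / N) := by gcongr
      _ = 2 * N + 3 * L * N := by field_simp
      _ ≤ _ := by nlinarith
  · exact one_div_le_one_div_of_le (by norm_num) hN2

/-- The coefficients depend only on the coins at `i`, and dropping `j = i` and `k = i` makes them
vanish on exactly those coins. The variance proxy is at most `N` times the degree of `i`, so it
stays in the threshold as a random term. -/
lemma measureReal_paths_le (Q : Sym2 V → unitInterval) {r L : ℝ} (hQ : ∀ e, (Q e : ℝ) ≤ r)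
    (s : V → ℝ) (hs : ∀ k, |s k| ≤ 1) (hr : 2 ≤ r * Fintype.card V) (i : V) :
    (Measure.pi fun e ↦ bernoulliMeasure true false (Q e)).real
      {x | 2 * ∑ j, coinMatrix x i j + 3 * L * (r * Fintype.card V) <
        |∑ j, ∑ k, (if j = i ∨ k = i then 0 else coinMatrix x i j * s k)
          * (coinMatrix x j k - meanMatrix Q j k)|}
      ≤ 2 * Real.exp (-(3 * L)) := by
  set N : ℝ := (Fintype.card V : ℝ) with hN
  have hrN : 0 < r * N := by linarith
  have hr0 : 0 ≤ r := (Q s(i, i)).2.1.trans (hQ _)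
  have h01 : ∀ x : Sym2 V → Bool, ∀ j k, 0 ≤ coinMatrix x j k ∧ coinMatrix x j k ≤ 1 := by
    intro x j k
    rw [coinMatrix_apply, coin]
    split_ifs <;> norm_num
  refine (measureReal_mono fun x hx ↦ ?_).trans (measureReal_graph_abs Q hQ {e | i ∈ e}
    (fun x j k ↦ if j = i ∨ k = i then 0 else coinMatrix x i j * s k) ?_ ?_ ?_
    (l := 1 / (r * N)) (s := 3 * L) (by positivity) ?_)
  · simp only [Set.mem_ofPred_eq] at hx ⊢
    refine lt_of_le_of_lt ?_ hx
    have e2 : ∑ j, ∑ k, (if j = i ∨ k = i then 0 else coinMatrix x i j * s k) ^ 2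
        ≤ N * ∑ j, coinMatrix x i j := by
      calc _ ≤ ∑ j, ∑ _k : V, coinMatrix x i j := by
            refine Finset.sum_le_sum fun j _ ↦ Finset.sum_le_sum fun k _ ↦ ?_
            obtain ⟨h0, h1⟩ := h01 x i j
            split_ifs
            · simpa using h0
            · have : s k ^ 2 ≤ 1 := by simpa using hs k
              rw [mul_pow]
              nlinarith [mul_le_mul_of_nonneg_left this (sq_nonneg (coinMatrix x i j))]
        _ = _ := by simp [hN, Finset.mul_sum]
    calc _ ≤ 2 * (1 / (r * N)) * r * (N * ∑ j, coinMatrix x i j) + 3 * L / (1 / (r * N)) := by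
          gcongr
      _ = 2 * (r * N / (r * N)) * (∑ j, coinMatrix x i j) + 3 * L * (r * N) := by
          rw [div_div_eq_mul_div]; ring
      _ = _ := by rw [div_self hrN.ne']; ring
  · intro x y h
    funext j k
    split_ifs
    · rfl
    · rw [coinMatrix_apply, coinMatrix_apply, h s(i, j) (by simp)]
  · intro x j k h
    rw [if_pos]
    simpa [eq_comm] using h
  · intro x j k
    split_ifs
    · simp
    · obtain ⟨h0, h1⟩ := h01 x i j
      rw [abs_mul, abs_of_nonneg h0]
      exact mul_le_one₀ h1 (abs_nonneg _) (hs k)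
  · exact one_div_le_one_div_of_le (by norm_num) hr

lemma measureReal_not_isTypical_le (Q : Sym2 V → unitInterval) {r L : ℝ} (hQ : ∀ e, (Q e : ℝ) ≤ r)
    (s : V → ℝ) (hs : ∀ k, |s k| ≤ 1) (u : V → ℝ) (hu : ∀ k, |u k| ≤ 1) (hL : 1 ≤ L) (hr1 : r ≤ 1)
    (hr : 4 * L ≤ r * Fintype.card V) :
    (Measure.pi fun e ↦ bernoulliMeasure true false (Q e)).real
      {x | ¬ IsTypical (coinMatrix x) (meanMatrix Q) s u r L}
      ≤ 10 * Fintype.card V * Real.exp (-(3 * L)) := by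
  set μ := Measure.pi fun e ↦ bernoulliMeasure true false (Q e)
  set N : ℝ := (Fintype.card V : ℝ) with hN
  have hr0 : 0 < r := by
    by_contra h
    have : r * N ≤ 0 := mul_nonpos_of_nonpos_of_nonneg (not_lt.1 h) (by positivity)
    linarith
  have hN2 : 2 ≤ N := by nlinarith
  have hN2' : 2 ≤ Fintype.card V := by rw [hN] at hN2; exact_mod_cast hN2
  let B : V → Fin 4 → Set (Sym2 V → Bool) := fun i ↦
    ![{x | 5 * √(r * N * L) < |∑ k, 1 * (coinMatrix x i k - meanMatrix Q i k)|},
      {x | 5 * √(r * N * L) < |∑ k, s k * (coinMatrix x i k - meanMatrix Q i k)|},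
      {x | 5 * √(r * N * L) < |∑ k, u k * (coinMatrix x i k - meanMatrix Q i k)|},
      {x | 2 * ∑ j, coinMatrix x i j + 3 * L * (r * N) <
        |∑ j, ∑ k, (if j = i ∨ k = i then 0 else coinMatrix x i j * s k)
          * (coinMatrix x j k - meanMatrix Q j k)|}]
  let T : Set (Sym2 V → Bool) :=
    {x | 5 * L * N < |∑ j, ∑ k, s k * (coinMatrix x j k - meanMatrix Q j k)|}
  have hB : ∀ i t, μ.real (B i t) ≤ 2 * Real.exp (-(3 * L)) := by
    intro i t
    fin_cases t
    · exact measureReal_row_le Q hQ (fun _ ↦ 1) (by simp) hL hr i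
    · exact measureReal_row_le Q hQ s hs hL hr i
    · exact measureReal_row_le Q hQ u hu hL hr i
    · exact measureReal_paths_le Q hQ s hs (by linarith) i
  have hT : μ.real T ≤ 2 * Real.exp (-(3 * L)) := measureReal_total_le Q hQ s hs hL hr1 hN2'
  have hsub : {x | ¬ IsTypical (coinMatrix x) (meanMatrix Q) s u r L} ⊆ (⋃ i, ⋃ t, B i t) ∪ T := by
    intro x hx
    by_contra hn
    simp only [Set.mem_union, Set.mem_iUnion, not_or, not_exists] at hn
    obtain ⟨h1, h2⟩ := hn
    refine hx ⟨fun i ↦ ?_, fun i ↦ ?_, fun i ↦ ?_, fun i ↦ ?_, ?_⟩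
    · simpa [B] using h1 i 0
    · simpa [B] using h1 i 1
    · simpa [B] using h1 i 2
    · simpa [B] using h1 i 3
    · simpa [T] using h2
  calc _ ≤ μ.real ((⋃ i, ⋃ t, B i t) ∪ T) := measureReal_mono hsub
    _ ≤ μ.real (⋃ i, ⋃ t, B i t) + μ.real T := measureReal_union_le _ _
    _ ≤ ∑ _i : V, ∑ _t : Fin 4, 2 * Real.exp (-(3 * L)) + 2 * Real.exp (-(3 * L)) := by
        gcongr
        refine (measureReal_iUnion_fintype_le _).trans (Finset.sum_le_sum fun i _ ↦ ?_)
        exact (measureReal_iUnion_fintype_le _).trans (Finset.sum_le_sum fun t _ ↦ hB i t)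
    _ = (8 * N + 2) * Real.exp (-(3 * L)) := by
        simp only [Finset.sum_const, Finset.card_univ, Fintype.card_fin, nsmul_eq_mul, ← hN]
        push_cast; ring
    _ ≤ _ := by gcongr; linarith

end Graph

/-! ### The score of a vertex for a typical graph -/

/-- First-order Taylor expansion of the logarithm at `m`, applied at `x` and at `y`. Staying within
`m/2` of `m` keeps the remainder constant at 2. -/
lemma abs_log_sub_log_sub_le {x y m : ℝ} (hm : 0 < m) (hx : |x - m| ≤ m / 2)
    (hy : |y - m| ≤ m / 2) :
    |Real.log x - Real.log y - (x - y) / m| ≤ 2 * ((x - m) ^ 2 + (y - m) ^ 2) / m ^ 2 := by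
  have key : ∀ w : ℝ, |w - m| ≤ m / 2 →
      |Real.log w - Real.log m - (w - m) / m| ≤ 2 * (w - m) ^ 2 / m ^ 2 := by
    intro w hw
    have hw0 : 0 < w := by linarith [(abs_le.1 hw).1]
    have hz : |(m - w) / m| ≤ 1 / 2 := by
      rw [abs_div, abs_of_pos hm, abs_sub_comm, div_le_iff₀ hm]; linarith
    have h := Real.abs_log_sub_add_sum_range_le (x := (m - w) / m) (by linarith) 1
    have e1 : 1 - (m - w) / m = w / m := by field_simp; ring
    simp only [Finset.sum_range_one, zero_add, pow_one, Nat.cast_zero, div_one, e1] at h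
    rw [Real.log_div hw0.ne' hm.ne'] at h
    have e2 : Real.log w - Real.log m - (w - m) / m
        = (m - w) / m + (Real.log w - Real.log m) := by ring
    rw [e2]
    refine h.trans ?_
    rw [sq_abs, div_le_iff₀ (by linarith)]
    have e3 : 2 * (w - m) ^ 2 / m ^ 2 = 2 * ((m - w) / m) ^ 2 := by
      field_simp; ring
    rw [e3]
    nlinarith [sq_nonneg ((m - w) / m)]
  have e : Real.log x - Real.log y - (x - y) / m
      = (Real.log x - Real.log m - (x - m) / m) - (Real.log y - Real.log m - (y - m) / m) := by ring
  rw [e]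
  refine (abs_sub _ _).trans ((add_le_add (key x hx) (key y hy)).trans_eq ?_)
  ring

lemma abs_log_sub_log_le {x y a : ℝ} (ha : 0 < a) (hx : a ≤ x) (hy : a ≤ y) :
    |Real.log x - Real.log y| ≤ |x - y| / a := by
  have key : ∀ v w : ℝ, a ≤ v → a ≤ w → Real.log v - Real.log w ≤ |v - w| / a := by
    intro v w hv hw
    have hv0 : 0 < v := ha.trans_le hv
    have hw0 : 0 < w := ha.trans_le hw
    rw [← Real.log_div hv0.ne' hw0.ne']
    calc Real.log (v / w) ≤ v / w - 1 := Real.log_le_sub_one_of_pos (by positivity)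
      _ = (v - w) / w := by field_simp
      _ ≤ |v - w| / w := by gcongr; exact le_abs_self _
      _ ≤ |v - w| / a := by gcongr
  rw [abs_le]
  have h1 := key x y hx hy
  have h2 := key y x hy hx
  rw [abs_sub_comm] at h2
  constructor <;> linarith

section Score

variable {V : Type*} [Fintype V]

/-- Off the diagonal `M` agrees with a matrix of rank at most two, spanned by the all-ones vector
and `u`. That matrix has diagonal entries `p`, which accounts for the correction `-p v_i`. -/
lemma sum_mul_blockMean (M : Matrix V V ℝ) (u : V → ℝ) (hu : ∀ i, u i * u i = 1) (p q : ℝ)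
    (hM : ∀ i k, M i k = if i = k then 0 else (p + q) / 2 + (p - q) / 2 * (u i * u k))
    (v : V → ℝ) (i : V) :
    ∑ k, v k * M i k
      = (p + q) / 2 * ∑ k, v k + (p - q) / 2 * u i * (∑ k, v k * u k) - p * v i := by
  have h : ∀ k, v k * M i k = (p + q) / 2 * v k + (p - q) / 2 * u i * (v k * u k)
      - if i = k then p * v k else 0 := by
    intro k
    rw [hM]
    split_ifs with h
    · subst h; linear_combination (-(p - q) / 2 * v i) * hu i
    · ring
  simp only [h, Finset.sum_sub_distrib, Finset.sum_add_distrib, Finset.mul_sum, Finset.sum_ite_eq,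
    Finset.mem_univ, if_true]

/-- The weight of row `j` of `A` over the part of sign `t` of the partition with signs `s`. -/
def cellDegree (A : Matrix V V ℝ) (s : V → ℝ) (t : ℝ) (j : V) : ℝ :=
  ∑ k, (1 + t * s k) / 2 * A j k

/-- The rescaled difference of the log-likelihoods of the vertex `i` under the means of the two
parts of the partition with signs `s`. -/
def score (A : Matrix V V ℝ) (s : V → ℝ) (i : V) : ℝ :=
  ∑ j, A i j * (Real.log (cellDegree A s 1 j) - Real.log (cellDegree A s (-1) j))
    - (∑ j, A i j) *
      (Real.log (∑ j, cellDegree A s 1 j) - Real.log (∑ j, cellDegree A s (-1) j))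

lemma cellDegree_add (A : Matrix V V ℝ) (s : V → ℝ) (j : V) :
    cellDegree A s 1 j + cellDegree A s (-1) j = ∑ k, A j k := by
  rw [cellDegree, cellDegree, ← Finset.sum_add_distrib]
  exact Finset.sum_congr rfl fun k _ ↦ by ring

lemma cellDegree_sub (A : Matrix V V ℝ) (s : V → ℝ) (j : V) :
    cellDegree A s 1 j - cellDegree A s (-1) j = ∑ k, s k * A j k := by
  rw [cellDegree, cellDegree, ← Finset.sum_sub_distrib]
  exact Finset.sum_congr rfl fun k _ ↦ by ring

variable {A M : Matrix V V ℝ} {s u : V → ℝ} {p q L : ℝ}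

/-- The three error terms are the fluctuation of the row (half from its plain sum, half from its
signed sum), the drift caused by the overlap, and the missing diagonal. -/
lemma abs_cellDegree_sub_le (hp : 0 ≤ p) (hqp : q ≤ p)
    (hs : ∀ i, |s i| = 1) (hu : ∀ i, |u i| = 1) (hs0 : ∑ i, s i = 0) (hu0 : ∑ i, u i = 0)
    (hM : ∀ i k, M i k = if i = k then 0 else (p + q) / 2 + (p - q) / 2 * (u i * u k))
    (hA : IsTypical A M s u p L) {t : ℝ} (ht : |t| = 1) (j : V) :
    |cellDegree A s t j - (p + q) * Fintype.card V / 4|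
      ≤ 5 * √(p * Fintype.card V * L) + (p - q) * |∑ k, s k * u k| / 4 + p := by
  set N : ℝ := (Fintype.card V : ℝ) with hN
  set R := √(p * N * L)
  set D := ∑ k, s k * u k
  have huu : ∀ i, u i * u i = 1 := fun i ↦ by rw [← abs_mul_abs_self, hu, one_mul]
  have h1 := sum_mul_blockMean M u huu p q hM (fun _ ↦ 1) j
  have h2 := sum_mul_blockMean M u huu p q hM s j
  simp only [one_mul, Finset.sum_const, Finset.card_univ, nsmul_eq_mul, mul_one, ← hN, hu0,
    mul_zero, add_zero] at h1
  rw [hs0] at h2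
  have e : cellDegree A s t j - (p + q) * N / 4
      = (∑ k, (A j k - M j k)) / 2 + t * (∑ k, s k * (A j k - M j k)) / 2
        + t * ((p - q) * (u j * D)) / 4 + (-(p / 2) + t * (-(p / 2) * s j)) := by
    have e1 : cellDegree A s t j = (∑ k, A j k) / 2 + t * (∑ k, s k * A j k) / 2 := by
      simp only [cellDegree, Finset.mul_sum, Finset.sum_div, ← Finset.sum_add_distrib]
      exact Finset.sum_congr rfl fun k _ ↦ by ring
    simp only [mul_sub, Finset.sum_sub_distrib, h1, h2, e1]
    ring
  rw [e]
  have b1 := hA.row_one j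
  have b2 := hA.row_init j
  have c1 : |t * (∑ k, s k * (A j k - M j k)) / 2| ≤ 5 * R / 2 := by
    rw [abs_div, abs_mul, ht, one_mul, abs_two]; gcongr
  have c2 : |(∑ k, (A j k - M j k)) / 2| ≤ 5 * R / 2 := by
    rw [abs_div, abs_two]; gcongr
  have c3 : |t * ((p - q) * (u j * D)) / 4| = (p - q) * |D| / 4 := by
    rw [abs_div, abs_mul, abs_mul, abs_mul, ht, hu, abs_of_nonneg (sub_nonneg.2 hqp)]
    norm_num
  have c4 : |-(p / 2) + t * (-(p / 2) * s j)| ≤ p := by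
    refine (abs_add_le _ _).trans ?_
    rw [abs_mul, abs_mul, ht, hs, abs_neg, abs_of_nonneg (by positivity)]
    linarith
  refine (abs_add_le _ _).trans ((add_le_add ((abs_add_le _ _).trans
    (add_le_add (abs_add_le _ _) le_rfl)) le_rfl).trans ?_)
  linarith

/-- A lower bound for the linear part of the score. -/
lemma le_linearScore (hp : 0 ≤ p) (hq : 0 ≤ q) (hqp : q ≤ p) (hp1 : p ≤ 1) (hL : 1 ≤ L)
    (hs : ∀ i, |s i| = 1) (hu : ∀ i, |u i| = 1) (hs0 : ∑ i, s i = 0)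
    (hM : ∀ i k, M i k = if i = k then 0 else (p + q) / 2 + (p - q) / 2 * (u i * u k))
    (hdiag : ∀ i, A i i = 0) (hA0 : ∀ i j, 0 ≤ A i j)
    (hA1 : ∀ i j, A i j ≤ 1) (hA : IsTypical A M s u p L)
    (hR : 24 * √(p * Fintype.card V * L) ≤ (p - q) * Fintype.card V)
    (hN1 : 1 ≤ p * Fintype.card V)
    (i : V) (hd : ∑ j, A i j ≤ 2 * (p * Fintype.card V)) {t : ℝ} (ht : |t| = 1)
    (htD : t * ∑ k, s k * u k = |∑ k, s k * u k|) (hu0 : ∑ i, u i = 0) :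
    (p - q) ^ 2 * |∑ k, s k * u k| * Fintype.card V / 8 - 11 * L * (p * Fintype.card V)
      ≤ u i * t * ∑ j, A i j * ∑ k, s k * A j k := by
  set N : ℝ := (Fintype.card V : ℝ) with hN
  set R := √(p * N * L)
  set D := ∑ k, s k * u k
  set d := ∑ j, A i j
  have huu : ∀ i, u i * u i = 1 := fun i ↦ by rw [← abs_mul_abs_self, hu, one_mul]
  have hd0 : 0 ≤ d := Finset.sum_nonneg fun j _ ↦ hA0 i j
  have hR1 : 1 ≤ R := Real.one_le_sqrt.2 (by nlinarith)
  have hM01 : ∀ j k, 0 ≤ M j k ∧ M j k ≤ 1 := by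
    intro j k
    rw [hM]
    split_ifs
    · simp
    · have h : |u j * u k| ≤ 1 := by rw [abs_mul, hu, hu, one_mul]
      rw [abs_le] at h
      constructor <;> nlinarith
  have hAM : ∀ j k, |A j k - M j k| ≤ 1 := fun j k ↦ by
    rw [abs_le]; constructor <;> linarith [hA0 j k, hA1 j k, (hM01 j k).1, (hM01 j k).2]
  set Z := ∑ j, ∑ k, (if j = i ∨ k = i then 0 else A i j * s k) * (A j k - M j k)
  -- The decoupled statistic `Z` omits the steps that return to `i`. They contribute at most the
  -- degree of `i`, so restoring them is cheap.
  have hZ : ∑ j, A i j * ∑ k, s k * (A j k - M j k) = Z + s i * ∑ j, A i j * (A j i - M j i) := by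
    rw [Finset.mul_sum, ← Finset.sum_add_distrib]
    refine Finset.sum_congr rfl fun j _ ↦ ?_
    by_cases hj : j = i
    · subst hj; simp [hdiag]
    · have : ∀ k, (if j = i ∨ k = i then 0 else A i j * s k) * (A j k - M j k)
          = A i j * (s k * (A j k - M j k)) - if k = i then A i j * (s k * (A j k - M j k)) else 0 := by
        intro k
        by_cases hk : k = i <;> simp [hj, hk]; ring
      simp only [this, Finset.sum_sub_distrib, Finset.sum_ite_eq', Finset.mem_univ, if_true,
        ← Finset.mul_sum]
      ring
  have hlin : ∑ j, A i j * ∑ k, s k * A j k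
      = Z + s i * ∑ j, A i j * (A j i - M j i) + (p - q) / 2 * D * ∑ j, u j * A i j
        - p * ∑ j, A i j * s j := by
    rw [← hZ]
    have : ∀ j, A i j * ∑ k, s k * A j k = A i j * ∑ k, s k * (A j k - M j k)
        + (p - q) / 2 * D * (u j * A i j) - p * (A i j * s j) := by
      intro j
      have h2 := sum_mul_blockMean M u huu p q hM s j
      rw [hs0] at h2
      simp only [mul_sub, Finset.sum_sub_distrib, h2]
      ring
    simp only [this, Finset.sum_sub_distrib, Finset.sum_add_distrib, Finset.mul_sum]
  have b1 : |u i * t * Z| ≤ 2 * d + 3 * L * (p * N) := by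
    rw [abs_mul, abs_mul, hu, ht, one_mul, one_mul]; exact hA.paths i
  have b2 : |u i * t * (s i * ∑ j, A i j * (A j i - M j i))| ≤ d := by
    rw [abs_mul, abs_mul, abs_mul, hu, hs, ht, one_mul, one_mul, one_mul]
    refine (Finset.abs_sum_le_sum_abs _ _).trans (Finset.sum_le_sum fun j _ ↦ ?_)
    rw [abs_mul, abs_of_nonneg (hA0 i j)]
    exact mul_le_of_le_one_right (hA0 i j) (hAM j i)
  have b3 : |u i * t * (p * ∑ j, A i j * s j)| ≤ d := by
    rw [abs_mul, abs_mul, abs_mul, hu, ht, one_mul, one_mul, abs_of_nonneg hp]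
    refine (mul_le_of_le_one_left (abs_nonneg _) hp1).trans
      ((Finset.abs_sum_le_sum_abs _ _).trans (Finset.sum_le_sum fun j _ ↦ ?_))
    rw [abs_mul, abs_of_nonneg (hA0 i j), hs, mul_one]
  -- The expected excess is `(p-q)N/2 - p`. The losses `5R` and `p ≤ R` total at most `6R`, which
  -- `hR` bounds by `(p-q)N/4`; this is the origin of the constant 24.
  have b4 : (p - q) * N / 4 ≤ u i * ∑ j, u j * A i j := by
    have h2 := sum_mul_blockMean M u huu p q hM u i
    simp only [hu0, huu, Finset.sum_const, Finset.card_univ, nsmul_eq_mul, mul_one, ← hN,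
      mul_zero, zero_add] at h2
    have h3 : u i * ∑ j, u j * A i j = u i * ∑ k, u k * (A i k - M i k)
        + ((p - q) / 2 * N - p) := by
      simp only [mul_sub, Finset.sum_sub_distrib, h2]
      linear_combination ((p - q) / 2 * N - p) * huu i
    have h4 : |u i * ∑ k, u k * (A i k - M i k)| ≤ 5 * R := by
      rw [abs_mul, hu, one_mul]; exact hA.row_block i
    rw [h3]
    linarith [(abs_le.1 h4).1]
  have b5 : (p - q) ^ 2 * |D| * N / 8 ≤ u i * t * ((p - q) / 2 * D * ∑ j, u j * A i j) := by
    have e : u i * t * ((p - q) / 2 * D * ∑ j, u j * A i j)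
        = (p - q) / 2 * |D| * (u i * ∑ j, u j * A i j) := by rw [← htD]; ring
    rw [e]
    have : 0 ≤ (p - q) / 2 * |D| := mul_nonneg (by linarith) (abs_nonneg _)
    calc _ = (p - q) / 2 * |D| * ((p - q) * N / 4) := by ring
      _ ≤ _ := by gcongr
  have hLN : p * N ≤ L * (p * N) := le_mul_of_one_le_left (by linarith) hL
  rw [hlin, mul_sub, mul_add, mul_add]
  linarith [(abs_le.1 b1).1, (abs_le.1 b2).1, (abs_le.1 b3).2]

lemma cellDegree_near (hp : 0 < p) (hp1 : p ≤ 1) (hq : 0 ≤ q) (hqp : q ≤ p)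
    (hL : 1 ≤ L) (hs : ∀ i, |s i| = 1) (hu : ∀ i, |u i| = 1) (hs0 : ∑ i, s i = 0)
    (hu0 : ∑ i, u i = 0)
    (hM : ∀ i k, M i k = if i = k then 0 else (p + q) / 2 + (p - q) / 2 * (u i * u k))
    (hA : IsTypical A M s u p L) (hN : 25600 * L ≤ p * Fintype.card V)
    (hD : |∑ k, s k * u k| ≤ Fintype.card V / 100) {t : ℝ} (ht : |t| = 1) (j : V) :
    |cellDegree A s t j - (p + q) * Fintype.card V / 4| ≤ (p + q) * Fintype.card V / 4 / 2 := by
  refine (abs_cellDegree_sub_le hp.le hqp hs hu hs0 hu0 hM hA ht j).trans ?_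
  set N : ℝ := (Fintype.card V : ℝ)
  -- The constant 25600 in `hN` is `160²`.
  have h1 : √(p * N * L) ≤ p * N / 160 :=
    Real.sqrt_le_iff.2 ⟨by linarith, by nlinarith⟩
  have h2 : 0 ≤ q * N := by positivity
  have h3 : (p - q) * |∑ k, s k * u k| ≤ p * (N / 100) :=
    mul_le_mul (by linarith) hD (abs_nonneg _) hp.le
  nlinarith

set_option maxHeartbeats 800000 in
/-- For a typical graph, the sign of the score of each vertex tells its block. -/
lemma score_pos (hp : 0 < p) (hp1 : p ≤ 1) (hq : 0 ≤ q) (hqp : q ≤ p)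
    (hL : 1 ≤ L) (hs : ∀ i, |s i| = 1) (hu : ∀ i, |u i| = 1) (hs0 : ∑ i, s i = 0)
    (hu0 : ∑ i, u i = 0)
    (hM : ∀ i k, M i k = if i = k then 0 else (p + q) / 2 + (p - q) / 2 * (u i * u k))
    (hdiag : ∀ i, A i i = 0) (hA0 : ∀ i j, 0 ≤ A i j)
    (hA1 : ∀ i j, A i j ≤ 1)
    (hA : IsTypical A M s u p L) (hN : 25600 * L ≤ p * Fintype.card V)
    (hD : |∑ k, s k * u k| ≤ Fintype.card V / 100)
    (hR : 24 * √(p * Fintype.card V * L) ≤ (p - q) * Fintype.card V)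
    (hS : 10000 * L * p ≤ (p - q) ^ 2 * |∑ k, s k * u k|) {t : ℝ} (ht : |t| = 1)
    (htD : t * ∑ k, s k * u k = |∑ k, s k * u k|) (i : V) :
    0 < u i * t * score A s i := by
  have near := fun {t : ℝ} (ht : |t| = 1) j ↦
    cellDegree_near hp hp1 hq hqp hL hs hu hs0 hu0 hM hA hN hD ht j
  have dev := fun {t : ℝ} (ht : |t| = 1) j ↦
    abs_cellDegree_sub_le hp.le hqp hs hu hs0 hu0 hM hA ht j
  have lin := le_linearScore hp.le hq hqp hp1 hL hs hu hs0 hM hdiag hA0 hA1 hA hR (by linarith) i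
  set N : ℝ := (Fintype.card V : ℝ) with hNdef
  set R := √(p * N * L) with hRdef
  set D := ∑ k, s k * u k
  set d := ∑ j, A i j with hd
  set m := (p + q) * N / 4 with hm
  set r := 5 * R + (p - q) * |D| / 4 + p with hr
  have h11 : |(1 : ℝ)| = 1 := abs_one
  have h1m : |(-1 : ℝ)| = 1 := by simp
  have hpN : 0 < p * N := by linarith
  have hN0 : 0 < N := by
    by_contra h
    nlinarith
  have hqN : 0 ≤ q * N := by positivity
  have hm0 : 0 < m := by linarith [add_mul p q N]
  have hmu : m ≤ p * N / 2 := by nlinarith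
  have hd0 : 0 ≤ d := Finset.sum_nonneg fun j _ ↦ hA0 i j
  have hd3 : d ≤ 3 * m := by
    rw [hd, ← cellDegree_add A s i]
    linarith [(abs_le.1 (near h11 i)).2, (abs_le.1 (near h1m i)).2]
  have lin := lin (by linarith) ht htD hu0
  have hut : |u i * t| = 1 := by rw [abs_mul, hu, ht, one_mul]
  set x := cellDegree A s 1 with hx
  set y := cellDegree A s (-1) with hy
  -- Replacing the logarithms by their linear parts costs the squared deviation `r²` from each
  -- neighbour.
  have quad : |∑ j, A i j * (Real.log (x j) - Real.log (y j)) - (∑ j, A i j * (x j - y j)) / m|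
      ≤ d * (4 * r ^ 2 / m ^ 2) := by
    rw [Finset.sum_div, ← Finset.sum_sub_distrib, hd, Finset.sum_mul]
    refine (Finset.abs_sum_le_sum_abs _ _).trans (Finset.sum_le_sum fun j _ ↦ ?_)
    rw [mul_div_assoc, ← mul_sub, abs_mul, abs_of_nonneg (hA0 i j)]
    refine mul_le_mul_of_nonneg_left ?_ (hA0 i j)
    refine (abs_log_sub_log_sub_le hm0 (near h11 j) (near h1m j)).trans ?_
    have e1 : (x j - m) ^ 2 ≤ r ^ 2 := sq_le_sq' (abs_le.1 (dev h11 j)).1 (abs_le.1 (dev h11 j)).2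
    have e2 : (y j - m) ^ 2 ≤ r ^ 2 := sq_le_sq' (abs_le.1 (dev h1m j)).1 (abs_le.1 (dev h1m j)).2
    exact div_le_div_of_nonneg_right (by linarith) (sq_nonneg m)
  have tot : |∑ j, x j - ∑ j, y j| ≤ 5 * L * N := by
    rw [← Finset.sum_sub_distrib]
    simp only [hx, hy, cellDegree_sub]
    -- All expected degrees are equal and both cells have the same size, so the two totals differ
    -- only by fluctuation.
    have h0 : ∑ j, ∑ k, s k * M j k = 0 := by
      have huu : ∀ i, u i * u i = 1 := fun i ↦ by rw [← abs_mul_abs_self, hu, one_mul]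
      simp only [sum_mul_blockMean M u huu p q hM s, hs0, mul_zero, zero_add,
        Finset.sum_sub_distrib, ← Finset.sum_mul, ← Finset.mul_sum, hu0]
      ring
    have := hA.total
    simp only [mul_sub, Finset.sum_sub_distrib, h0, sub_zero] at this
    exact this
  have lower : ∀ t : ℝ, |t| = 1 → N * (m / 2) ≤ ∑ j, cellDegree A s t j := by
    intro t ht
    calc N * (m / 2) = ∑ _j : V, m / 2 := by simp [hNdef]
      _ ≤ _ := Finset.sum_le_sum fun j _ ↦ by linarith [(abs_le.1 (near ht j)).1]
  have tot' : |Real.log (∑ j, x j) - Real.log (∑ j, y j)| ≤ 5 * L * N / (N * (m / 2)) :=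
    (abs_log_sub_log_le (by positivity) (lower 1 h11) (lower (-1) h1m)).trans (by gcongr)
  have b1 := mul_le_mul_of_nonneg_left tot' hd0
  have e1 : u i * t * score A s i = u i * t *
        (∑ j, A i j * (Real.log (x j) - Real.log (y j)) - (∑ j, A i j * (x j - y j)) / m)
      + (u i * t * ∑ j, A i j * (x j - y j)) / m
      - u i * t * (d * (Real.log (∑ j, x j) - Real.log (∑ j, y j))) := by
    rw [score]; ring
  have b2 : |u i * t *
      (∑ j, A i j * (Real.log (x j) - Real.log (y j)) - (∑ j, A i j * (x j - y j)) / m)|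
      ≤ d * (4 * r ^ 2 / m ^ 2) := by rw [abs_mul, hut, one_mul]; exact quad
  have b3 : |u i * t * (d * (Real.log (∑ j, x j) - Real.log (∑ j, y j)))|
      ≤ d * (5 * L * N / (N * (m / 2))) := by
    rw [abs_mul, hut, one_mul, abs_mul, abs_of_nonneg hd0]; exact b1
  have b4 : d * (4 * r ^ 2 / m ^ 2) * m ≤ 12 * r ^ 2 := by
    have : d * (4 * r ^ 2 / m ^ 2) * m = d / m * (4 * r ^ 2) := by field_simp
    rw [this]
    have : d / m ≤ 3 := by rwa [div_le_iff₀ hm0]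
    nlinarith [sq_nonneg r]
  have b5 : d * (5 * L * N / (N * (m / 2))) * m ≤ 15 * L * (p * N) := by
    have : d * (5 * L * N / (N * (m / 2))) * m = 10 * L * d := by field_simp; ring
    rw [this]
    nlinarith
  have b6 : (u i * t * ∑ j, A i j * (x j - y j)) / m * m = u i * t * ∑ j, A i j * ∑ k, s k * A j k := by
    rw [div_mul_cancel₀ _ hm0.ne']
    simp only [hx, hy, cellDegree_sub]
  have hRR : R ^ 2 = p * N * L := Real.sq_sqrt (by positivity)
  have hR1 : 1 ≤ R := Real.one_le_sqrt.2 (by nlinarith)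
  have b7 : r ^ 2 ≤ 3 * (26 * (p * N * L) + ((p - q) * |D|) ^ 2 / 16) := by
    rw [← hRR, hr]
    have h1 : p ^ 2 ≤ R ^ 2 := pow_le_pow_left₀ hp.le (hp1.trans hR1) 2
    have h2 : ∀ a b c : ℝ, (a + b + c) ^ 2 ≤ 3 * (a ^ 2 + b ^ 2 + c ^ 2) := fun a b c ↦ by
      nlinarith [sq_nonneg (a - b), sq_nonneg (a - c), sq_nonneg (b - c)]
    refine (h2 _ _ _).trans ?_
    linear_combination 3 * h1
  have b8 : ((p - q) * |D|) ^ 2 ≤ (p - q) ^ 2 * |D| * N / 100 := by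
    have : 0 ≤ (p - q) ^ 2 * |D| := by positivity
    calc ((p - q) * |D|) ^ 2 = (p - q) ^ 2 * |D| * |D| := by ring
      _ ≤ (p - q) ^ 2 * |D| * (N / 100) := by gcongr
      _ = _ := by ring
  have b9 : 10000 * L * p * N ≤ (p - q) ^ 2 * |D| * N := by gcongr
  have pos : 0 < p * N * L := by positivity
  -- In units of `pNL` the errors are 11 (paths), 936 (remainder) and 15 (normalisation), 962 in
  -- all. The remainder also takes `9/400` of `(p-q)²|D|N` from the signal's `1/8`; what is left is
  -- at least 1025 by `b9`.
  have fin : 0 < u i * t * score A s i * m := by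
    rw [e1, sub_mul, add_mul, b6]
    have c2 := mul_le_mul_of_nonneg_right (abs_le.1 b2).1 hm0.le
    have c3 := mul_le_mul_of_nonneg_right (abs_le.1 b3).2 hm0.le
    rw [neg_mul] at c2
    linarith
  exact pos_of_mul_pos_left fin hm0.le

end Score

/-! ### One iteration of DER in terms of scores -/

/-- The sign of a label. -/
def labelSign (a : Fin 2) : ℝ := if a = 0 then 1 else -1

lemma abs_labelSign (a : Fin 2) : |labelSign a| = 1 := by
  rw [labelSign]; split_ifs <;> simp

lemma labelSign_mul (a b : Fin 2) : labelSign a * labelSign b = if b = a then 1 else -1 := by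
  fin_cases a <;> fin_cases b <;> simp [labelSign]

section Step

variable {V : Type*} [Fintype V] {A : Matrix V V ℝ} {σ : V → Fin 2}

lemma sum_cells_eq_cellDegree (hsymm : ∀ i j, A i j = A j i) (l : Fin 2) (j : V) :
    ∑ i ∈ cells σ l, A i j = cellDegree A (fun k ↦ labelSign (σ k)) (labelSign l) j := by
  rw [cells, Finset.sum_filter, cellDegree]
  refine Finset.sum_congr rfl fun k _ ↦ ?_
  rw [labelSign_mul, hsymm k j]
  split_ifs <;> simp

lemma walk_one (i j : V) : DER.walk A 1 i j = A i j / DER.degree A i := by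
  simp [DER.walk, DER.transition]

lemma mean_one (hsymm : ∀ i j, A i j = A j i) (hdeg : ∀ i, DER.degree A i ≠ 0) (l : Fin 2) (j : V) :
    DER.mean A 1 (cells σ l) j = cellDegree A (fun k ↦ labelSign (σ k)) (labelSign l) j
      / ∑ j, cellDegree A (fun k ↦ labelSign (σ k)) (labelSign l) j := by
  have h1 : ∑ i ∈ cells σ l, DER.degree A i
      = ∑ j, cellDegree A (fun k ↦ labelSign (σ k)) (labelSign l) j := by
    simp only [DER.degree]
    refine Finset.sum_comm.trans ?_
    exact Finset.sum_congr rfl fun j _ ↦ sum_cells_eq_cellDegree hsymm l j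
  rw [DER.mean, h1, ← sum_cells_eq_cellDegree hsymm l j, one_div, inv_mul_eq_div]
  congr 1
  refine Finset.sum_congr rfl fun i _ ↦ ?_
  rw [walk_one, mul_div_cancel₀ _ (hdeg i)]

lemma logLik_eq_coe {ν μ : V → ℝ} (hμ : ∀ j, 0 < μ j) :
    DER.logLik ν μ = ((∑ j, ν j * Real.log (μ j) : ℝ) : EReal) := by
  have coe_sum : ∀ f : V → ℝ, ((∑ j, f j : ℝ) : EReal) = ∑ j, (f j : EReal) := fun f ↦
    map_sum (⟨⟨Real.toEReal, EReal.coe_zero⟩, EReal.coe_add⟩ : ℝ →+ EReal) f _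
  rw [DER.logLik, coe_sum]
  refine Finset.sum_congr rfl fun j _ ↦ ?_
  rw [ENNReal.log_ofReal_of_pos (hμ j), EReal.coe_mul]

/-- Positive cell degrees make both likelihoods finite, so the comparison in `EReal` is one of real
numbers. Multiplying by the positive degree of `i` turns their difference into the score. -/
lemma mem_step_iff (hsymm : ∀ i j, A i j = A j i)
    (hpos : ∀ l j, 0 < cellDegree A (fun k ↦ labelSign (σ k)) (labelSign l) j) (l : Fin 2) (i : V) :
    i ∈ DER.step A 1 (cells σ) l ↔ 0 < labelSign l * score A (fun k ↦ labelSign (σ k)) i := by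
  set s : V → ℝ := fun k ↦ labelSign (σ k)
  have hd : ∀ i, 0 < DER.degree A i := by
    intro i
    rw [DER.degree, ← cellDegree_add A s i]
    have h0 := hpos 0 i
    have h1 := hpos 1 i
    simp only [labelSign, if_true, one_ne_zero, if_false] at h0 h1
    exact add_pos h0 h1
  have hX : ∀ l, 0 < ∑ j, cellDegree A s (labelSign l) j :=
    fun l ↦ Finset.sum_pos (fun j _ ↦ hpos l j) ⟨i, Finset.mem_univ i⟩
  have hlik : ∀ l, DER.logLik (DER.walk A 1 i) (DER.mean A 1 (cells σ l))
      = (((∑ j, A i j * Real.log (cellDegree A s (labelSign l) j)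
        - (∑ j, A i j) * Real.log (∑ j, cellDegree A s (labelSign l) j)) / DER.degree A i : ℝ)
          : EReal) := by
    intro l
    have hmean := mean_one (σ := σ) hsymm (fun i ↦ (hd i).ne') l
    rw [logLik_eq_coe fun j ↦ by rw [hmean]; exact div_pos (hpos l j) (hX l)]
    congr 1
    rw [Finset.sum_mul, ← Finset.sum_sub_distrib, Finset.sum_div]
    refine Finset.sum_congr rfl fun j _ ↦ ?_
    rw [hmean, walk_one, Real.log_div (hpos l j).ne' (hX l).ne']
    ring
  have hsc : score A s i = (∑ j, A i j * Real.log (cellDegree A s (labelSign 0) j)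
        - (∑ j, A i j) * Real.log (∑ j, cellDegree A s (labelSign 0) j))
      - (∑ j, A i j * Real.log (cellDegree A s (labelSign 1) j)
        - (∑ j, A i j) * Real.log (∑ j, cellDegree A s (labelSign 1) j)) := by
    simp only [score, labelSign, if_true, one_ne_zero, if_false, mul_sub, Finset.sum_sub_distrib]
    ring
  rw [DER.step, Finset.mem_filter]
  simp only [Finset.mem_univ, true_and, hlik, EReal.coe_lt_coe_iff, div_lt_div_iff_of_pos_right (hd i),
    Fin.forall_fin_two, hsc]
  fin_cases l <;> simp [labelSign]

lemma recovers_of_score {P : V → Fin 2} (hsymm : ∀ i j, A i j = A j i)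
    (hpos : ∀ l j, 0 < cellDegree A (fun k ↦ labelSign (σ k)) (labelSign l) j) {a : Fin 2}
    (hscore : ∀ i, 0 < labelSign (P i) * labelSign a * score A (fun k ↦ labelSign (σ k)) i) :
    DER.Recovers (DER.step A 1 (cells σ)) P := by
  -- The sign `a` decides whether the new cells appear in the order of the blocks or swapped.
  refine ⟨if a = 0 then 1 else Equiv.swap 0 1, fun l ↦ ?_⟩
  ext i
  rw [mem_step_iff hsymm hpos, cells, Finset.mem_filter]
  have h := hscore i
  generalize score A (fun k ↦ labelSign (σ k)) i = x at h ⊢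
  generalize P i = b at h ⊢
  fin_cases a <;> fin_cases b <;> fin_cases l <;> simp [labelSign] at h ⊢ <;> linarith

end Step

/-! ### The overlap of a random balanced labelling with a fixed one -/

/-- This and the next lemma are squared, integer forms of `centralBinom k ≍ 4^k / √k`, both proved
from the ratio of consecutive central binomials. -/
lemma two_mul_add_one_mul_centralBinom_sq_le (k : ℕ) :
    (2 * k + 1) * k.centralBinom ^ 2 ≤ 16 ^ k := by
  induction k with
  | zero => simp
  | succ k ih =>
    have h := Nat.succ_mul_centralBinom_succ k
    have h2 : (k + 1) ^ 2 * ((2 * (k + 1) + 1) * (k + 1).centralBinom ^ 2)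
        = (2 * k + 3) * (4 * (2 * k + 1)) * ((2 * k + 1) * k.centralBinom ^ 2) := by
      calc _ = (2 * k + 3) * ((k + 1) * (k + 1).centralBinom) ^ 2 := by ring
        _ = _ := by rw [h]; ring
    refine Nat.le_of_mul_le_mul_left (c := (k + 1) ^ 2) ?_ (by positivity)
    rw [h2, pow_succ 16 k]
    calc _ ≤ (16 * (k + 1) ^ 2) * 16 ^ k := Nat.mul_le_mul (by nlinarith) ih
      _ = _ := by ring

lemma sixteen_pow_le_mul_centralBinom_sq {n : ℕ} (hn : 1 ≤ n) :
    16 ^ n ≤ 4 * n * n.centralBinom ^ 2 := by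
  induction n, hn using Nat.le_induction with
  | base => simp [Nat.centralBinom]
  | succ k hk ih =>
    have h := Nat.succ_mul_centralBinom_succ k
    refine Nat.le_of_mul_le_mul_left (c := (k + 1) * k) ?_ (by positivity)
    calc (k + 1) * k * 16 ^ (k + 1) = 16 * ((k + 1) * k) * 16 ^ k := by ring
      _ ≤ 16 * ((k + 1) * k) * (4 * k * k.centralBinom ^ 2) := by gcongr
      _ = 4 * k * ((4 * (k * (k + 1))) * (2 * k.centralBinom) ^ 2) := by ring
      _ ≤ 4 * k * ((2 * k + 1) ^ 2 * (2 * k.centralBinom) ^ 2) := by gcongr; nlinarith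
      _ = 4 * k * (2 * (2 * k + 1) * k.centralBinom) ^ 2 := by ring
      _ = _ := by rw [← h]; ring

lemma succ_mul_choose_half_sq_le (n : ℕ) : (n + 1) * n.choose (n / 2) ^ 2 ≤ 4 ^ n := by
  obtain ⟨k, rfl | rfl⟩ := n.even_or_odd'
  · have h := two_mul_add_one_mul_centralBinom_sq_le k
    rw [Nat.centralBinom] at h
    rw [Nat.mul_div_cancel_left k two_pos, pow_mul]
    exact h
  · have h := two_mul_add_one_mul_centralBinom_sq_le (k + 1)
    have e : (k + 1).centralBinom = 2 * (2 * k + 1).choose k := by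
      rw [Nat.centralBinom_eq_two_mul_choose, show 2 * (k + 1) = 2 * k + 1 + 1 by ring,
        Nat.choose_succ_succ, Nat.choose_symm_half]
      ring
    have hdiv : (2 * k + 1) / 2 = k := by omega
    rw [hdiv]
    rw [e, show (16 : ℕ) ^ (k + 1) = 4 * 4 ^ (2 * k + 1) by
      rw [pow_succ 4 (2 * k), pow_mul, pow_succ 16]; norm_num; ring] at h
    nlinarith

/-- The largest hypergeometric probability is of order `n ^ (-1 / 2)`. -/
lemma choose_half_sq_le {n : ℕ} (hn : 1 ≤ n) :
    ((n.choose (n / 2) : ℝ)) ^ 2 ≤ 2 / √n * n.centralBinom := by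
  have h1 : ((n : ℝ) + 1) * (n.choose (n / 2) : ℝ) ^ 2 ≤ 4 ^ n := by
    exact_mod_cast succ_mul_choose_half_sq_le n
  have h2 : (16 : ℝ) ^ n ≤ 4 * n * (n.centralBinom : ℝ) ^ 2 := by
    exact_mod_cast sixteen_pow_le_mul_centralBinom_sq hn
  have hn0 : (0 : ℝ) < n := by exact_mod_cast hn
  have h3 : (4 : ℝ) ^ n ≤ 2 * √n * n.centralBinom := by
    refine le_of_sq_le_sq ?_ (by positivity)
    calc ((4 : ℝ) ^ n) ^ 2 = 16 ^ n := by rw [← pow_mul, mul_comm, pow_mul]; norm_num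
      _ ≤ _ := h2
      _ = (2 * √n * n.centralBinom) ^ 2 := by
        rw [mul_pow, mul_pow, Real.sq_sqrt hn0.le]; ring
  have h4 : (n : ℝ) * (n.choose (n / 2) : ℝ) ^ 2 ≤ n * (2 / √n * n.centralBinom) := by
    calc (n : ℝ) * (n.choose (n / 2) : ℝ) ^ 2
        ≤ ((n : ℝ) + 1) * (n.choose (n / 2) : ℝ) ^ 2 := by gcongr; linarith
      _ ≤ 2 * √n * n.centralBinom := h1.trans h3
      _ = n * (2 / √n * n.centralBinom) := by
        have : (n : ℝ) / √n = √n := Real.div_sqrt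
        rw [← mul_assoc, mul_div_assoc', mul_comm (n : ℝ) 2, mul_div_assoc, this]
  exact le_of_mul_le_mul_left h4 hn0

section Labellings

variable {V : Type*} [Fintype V]

/-- The signed overlap of two labellings. -/
def overlap (σ P : V → Fin 2) : ℝ := ∑ k, labelSign (σ k) * labelSign (P k)

lemma sum_labelSign {σ : V → Fin 2} (hσ : σ ∈ balancedLabellings V 2) :
    ∑ k, labelSign (σ k) = 0 := by
  have h : ∀ k, labelSign (σ k) = 2 * (if σ k = 0 then 1 else 0) - 1 := fun k ↦ by
    rw [labelSign]; split_ifs <;> norm_num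
  have h0 : (2 : ℝ) * ((Finset.univ.filter fun i ↦ σ i = 0).card : ℝ) = Fintype.card V := by
    exact_mod_cast hσ 0
  simp only [h, Finset.sum_sub_distrib, ← Finset.mul_sum, Finset.sum_boole, h0]
  simp

lemma card_cells {σ : V → Fin 2} (hσ : σ ∈ balancedLabellings V 2) {n : ℕ}
    (hn : Fintype.card V = 2 * n) (a : Fin 2) : (cells σ a).card = n := by
  have := hσ a
  rw [cells]
  omega

/-- With balanced margins, one intersection size determines the overlap, so the overlap takes values
on a lattice of spacing 4. -/
lemma overlap_eq {σ P : V → Fin 2} (hσ : σ ∈ balancedLabellings V 2)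
    (hP : P ∈ balancedLabellings V 2) {n : ℕ} (hn : Fintype.card V = 2 * n) :
    overlap σ P = 4 * ((cells σ 0 ∩ cells P 0).card : ℝ) - 2 * n := by
  have h : ∀ k, labelSign (σ k) * labelSign (P k)
      = 4 * (if k ∈ cells σ 0 ∩ cells P 0 then 1 else 0) - labelSign (σ k) - labelSign (P k) - 1 := by
    intro k
    simp only [labelSign, cells, Finset.mem_inter, Finset.mem_filter, Finset.mem_univ, true_and]
    by_cases h1 : σ k = 0 <;> by_cases h2 : P k = 0 <;> simp [h1, h2]; norm_num
  rw [overlap]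
  simp only [h, Finset.sum_sub_distrib, ← Finset.mul_sum, sum_labelSign hσ, sum_labelSign hP,
    Finset.sum_boole]
  simp [hn, ← Finset.filter_mem_eq_inter, Finset.filter_and]

/-- The balanced labellings as a finite set. -/
def balancedFinset (V : Type*) [Fintype V] : Finset (V → Fin 2) :=
  Finset.univ.filter (· ∈ balancedLabellings V 2)

lemma mem_balancedFinset {σ : V → Fin 2} :
    σ ∈ balancedFinset V ↔ σ ∈ balancedLabellings V 2 := by
  simp [balancedFinset]

lemma labelling_ext {σ τ : V → Fin 2} (h : cells σ 0 = cells τ 0) : σ = τ := by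
  funext k
  have hk := congrArg (k ∈ ·) h
  simp only [cells, Finset.mem_filter, Finset.mem_univ, true_and, eq_iff_iff] at hk
  omega

lemma centralBinom_le_card_balancedFinset {n : ℕ} (hn : Fintype.card V = 2 * n) :
    n.centralBinom ≤ (balancedFinset V).card := by
  rw [Nat.centralBinom, ← hn, ← Finset.card_univ, ← Finset.card_powersetCard]
  refine Finset.card_le_card_of_injOn (fun S k ↦ if k ∈ S then 0 else 1) ?_ ?_
  · intro S hS
    have hS : S.card = n := (Finset.mem_powersetCard.1 hS).2
    refine mem_balancedFinset.2 fun a ↦ ?_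
    fin_cases a
    · have : (Finset.univ.filter fun i ↦ (if i ∈ S then (0 : Fin 2) else 1) = 0) = S := by
        ext i; simp
      simp only [Fin.zero_eta, this, hS, hn]
    · have : (Finset.univ.filter fun i ↦ (if i ∈ S then (0 : Fin 2) else 1) = 1) = Sᶜ := by
        ext i; simp
      simp only [Fin.mk_one, this, Finset.card_compl, hS, hn]
      omega
  · intro S _ T _ h
    ext k
    have := congrFun h k
    by_cases h1 : k ∈ S <;> by_cases h2 : k ∈ T <;> simp_all

/-- A labelling is determined by how its cell 0 meets each block. The number of choices is a product
of two binomials, each at most the middle one. -/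
lemma card_overlap_eq_le {P : V → Fin 2} (hP : P ∈ balancedLabellings V 2) {n : ℕ}
    (hn : Fintype.card V = 2 * n) (a : ℕ) :
    ((balancedFinset V).filter fun σ ↦ (cells σ 0 ∩ cells P 0).card = a).card
      ≤ n.choose (n / 2) ^ 2 := by
  have h : ((balancedFinset V).filter fun σ ↦ (cells σ 0 ∩ cells P 0).card = a).card
      ≤ (((cells P 0).powersetCard a) ×ˢ ((cells P 1).powersetCard (n - a))).card := by
    have hdisj : Disjoint (cells P 0) (cells P 1) := by
      rw [Finset.disjoint_left]; intro k; simp +contextual [cells]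
    have hun : ∀ S : Finset V, (S ∩ cells P 0) ∪ (S ∩ cells P 1) = S := by
      intro S
      ext k
      simp only [cells, Finset.mem_union, Finset.mem_inter, Finset.mem_filter, Finset.mem_univ,
        true_and]
      have : P k = 0 ∨ P k = 1 := by omega
      tauto
    refine Finset.card_le_card_of_injOn (fun σ ↦ (cells σ 0 ∩ cells P 0, cells σ 0 ∩ cells P 1)) ?_ ?_
    · intro σ hσ
      obtain ⟨h1, h2⟩ := Finset.mem_filter.1 hσ
      have h3 : (cells σ 0 ∩ cells P 0).card + (cells σ 0 ∩ cells P 1).card = n := by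
        rw [← Finset.card_union_of_disjoint
          (hdisj.mono Finset.inter_subset_right Finset.inter_subset_right), hun]
        exact card_cells (mem_balancedFinset.1 h1) hn 0
      simp only [Finset.coe_product, Set.mem_prod, Finset.mem_coe, Finset.mem_powersetCard]
      exact ⟨⟨Finset.inter_subset_right, h2⟩, Finset.inter_subset_right, by omega⟩
    · intro σ _ τ _ h
      simp only [Prod.mk.injEq] at h
      refine labelling_ext ?_
      rw [← hun (cells σ 0), ← hun (cells τ 0), h.1, h.2]
  refine h.trans ?_
  rw [Finset.card_product, Finset.card_powersetCard, Finset.card_powersetCard,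
    card_cells hP hn, card_cells hP hn, sq]
  exact Nat.mul_le_mul (Nat.choose_le_middle _ _) (Nat.choose_le_middle _ _)

/-- Anticoncentration: at most `T/2 + 1` lattice values satisfy `|overlap| < T`, and each carries a
share at most `2/√n` of the labellings. -/
lemma card_small_overlap_le {P : V → Fin 2} (hP : P ∈ balancedLabellings V 2) {n : ℕ}
    (hn : Fintype.card V = 2 * n) (hn1 : 1 ≤ n) {T : ℝ} (hT : 0 ≤ T) :
    (((balancedFinset V).filter fun σ ↦ |overlap σ P| < T).card : ℝ)
      ≤ (T / 2 + 1) * (2 / √n) * (balancedFinset V).card := by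
  set I : Finset ℕ := (Finset.range (n + 1)).filter fun a ↦ |4 * (a : ℝ) - 2 * n| < T
  have hI : (I.card : ℝ) ≤ T / 2 + 1 := by
    rcases I.eq_empty_or_nonempty with h | h
    · rw [h]; simp; positivity
    · set a0 := I.min' h
      have hsub : I ⊆ Finset.Icc a0 (a0 + ⌊T / 2⌋₊) := by
        intro a ha
        have h1 := I.min'_le a ha
        refine Finset.mem_Icc.2 ⟨h1, ?_⟩
        have h2 := abs_lt.1 (Finset.mem_filter.1 ha).2
        have h3 := abs_lt.1 (Finset.mem_filter.1 (I.min'_mem h)).2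
        have h4 : ((a - a0 : ℕ) : ℝ) ≤ T / 2 := by
          rw [Nat.cast_sub h1]; linarith
        have := Nat.le_floor h4
        omega
      have := Finset.card_le_card hsub
      rw [Nat.card_Icc] at this
      have h5 : (I.card : ℝ) ≤ ⌊T / 2⌋₊ + 1 := by
        have : I.card ≤ ⌊T / 2⌋₊ + 1 := by omega
        exact_mod_cast this
      linarith [Nat.floor_le (show 0 ≤ T / 2 by positivity)]
  have hcount : ((balancedFinset V).filter fun σ ↦ |overlap σ P| < T).card
      ≤ ∑ a ∈ I, ((balancedFinset V).filter fun σ ↦ (cells σ 0 ∩ cells P 0).card = a).card := by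
    refine (Finset.card_le_card fun σ hσ ↦ ?_).trans Finset.card_biUnion_le
    obtain ⟨h1, h2⟩ := Finset.mem_filter.1 hσ
    have h1' := mem_balancedFinset.1 h1
    rw [overlap_eq h1' hP hn] at h2
    refine Finset.mem_biUnion.2 ⟨_, Finset.mem_filter.2 ⟨Finset.mem_range.2 ?_, h2⟩,
      Finset.mem_filter.2 ⟨h1, rfl⟩⟩
    have := Finset.card_le_card (Finset.inter_subset_left (s₁ := cells σ 0) (s₂ := cells P 0))
    rw [card_cells h1' hn] at this
    omega
  have h6 : (((balancedFinset V).filter fun σ ↦ |overlap σ P| < T).card : ℝ)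
      ≤ I.card * (n.choose (n / 2) : ℝ) ^ 2 := by
    have := hcount.trans (Finset.sum_le_card_nsmul _ _ _ fun a _ ↦ card_overlap_eq_le hP hn a)
    rw [smul_eq_mul] at this
    exact_mod_cast this
  calc _ ≤ (I.card : ℝ) * (n.choose (n / 2) : ℝ) ^ 2 := h6
    _ ≤ (T / 2 + 1) * (2 / √n * n.centralBinom) := by gcongr; exact choose_half_sq_le hn1
    _ ≤ (T / 2 + 1) * (2 / √n * (balancedFinset V).card) := by
        gcongr; exact centralBinom_le_card_balancedFinset hn
    _ = _ := by ring

/-! ### Second moment of the overlap -/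

lemma comp_perm_mem_balancedFinset (π : Equiv.Perm V) {σ : V → Fin 2}
    (hσ : σ ∈ balancedFinset V) : σ ∘ π ∈ balancedFinset V := by
  rw [mem_balancedFinset] at hσ ⊢
  intro a
  rw [← hσ a]
  congr 1
  refine Finset.card_bij (fun i _ ↦ π i) (by simp) (by simp) fun j hj ↦ ⟨π.symm j, ?_⟩
  simpa using hj

/-- By exchangeability all correlations with `l ≠ k` coincide. Together with the diagonal one they
sum to zero, because the signs of a balanced labelling do. -/
lemma sum_labelSign_mul_labelSign {k l : V} (hkl : l ≠ k) :
    ((Fintype.card V : ℝ) - 1) * ∑ σ ∈ balancedFinset V, labelSign (σ k) * labelSign (σ l)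
      = -(balancedFinset V).card := by
  set W : V → ℝ := fun l ↦ ∑ σ ∈ balancedFinset V, labelSign (σ k) * labelSign (σ l)
  have hW : ∀ l', l' ≠ k → W l' = W l := by
    intro l' h
    refine Finset.sum_bij' (fun σ _ ↦ σ ∘ Equiv.swap l l') (fun σ _ ↦ σ ∘ Equiv.swap l l')
      (fun σ h ↦ comp_perm_mem_balancedFinset _ h) (fun σ h ↦ comp_perm_mem_balancedFinset _ h)
      (fun σ _ ↦ ?_) (fun σ _ ↦ ?_) fun σ _ ↦ ?_
    · funext; simp
    · funext; simp
    · simp [Equiv.swap_apply_of_ne_of_ne hkl.symm h.symm]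
  have hk : W k = (balancedFinset V).card := by
    have : ∀ σ : V → Fin 2, labelSign (σ k) * labelSign (σ k) = 1 := fun σ ↦ by
      rw [labelSign_mul, if_pos rfl]
    simp [W, this]
  have h0 : ∑ l', W l' = 0 := by
    simp only [W]
    rw [Finset.sum_comm]
    refine Finset.sum_eq_zero fun σ hσ ↦ ?_
    rw [← Finset.mul_sum, sum_labelSign (mem_balancedFinset.1 hσ), mul_zero]
  rw [← Finset.add_sum_erase _ _ (Finset.mem_univ k), hk,
    Finset.sum_congr rfl fun l' h ↦ hW l' (Finset.ne_of_mem_erase h), Finset.sum_const,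
    Finset.card_erase_of_mem (Finset.mem_univ k), Finset.card_univ, nsmul_eq_mul,
    Nat.cast_sub (Fintype.card_pos_iff.2 ⟨k⟩)] at h0
  push_cast at h0
  linarith

lemma sum_overlap_sq {P : V → Fin 2} (hP : P ∈ balancedLabellings V 2) (hV : 2 ≤ Fintype.card V) :
    ∑ σ ∈ balancedFinset V, overlap σ P ^ 2 ≤ 2 * Fintype.card V * (balancedFinset V).card := by
  set N : ℝ := (Fintype.card V : ℝ) with hN
  set b : ℝ := ((balancedFinset V).card : ℝ)
  have hN2 : 2 ≤ N := by rw [hN]; exact_mod_cast hV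
  have hb : 0 ≤ b := Nat.cast_nonneg _
  have hN1 : N - 1 ≠ 0 := by linarith
  set u : V → ℝ := fun k ↦ labelSign (P k) with hu
  have huu : ∀ k, u k * u k = 1 := fun k ↦ by simp only [hu]; rw [labelSign_mul, if_pos rfl]
  have hW : ∀ k l, ∑ σ ∈ balancedFinset V, labelSign (σ k) * labelSign (σ l)
      = (if k = l then b + b / (N - 1) else 0) - b / (N - 1) := by
    intro k l
    split_ifs with h
    · subst h
      simp [labelSign_mul, b]
    · have := sum_labelSign_mul_labelSign (Ne.symm h)
      rw [zero_sub, ← neg_div, eq_div_iff hN1, mul_comm]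
      exact this
  have h1 : ∑ σ ∈ balancedFinset V, overlap σ P ^ 2 = N * (b + b / (N - 1)) := by
    calc _ = ∑ k, ∑ l, u k * u l * ∑ σ ∈ balancedFinset V, labelSign (σ k) * labelSign (σ l) := by
          simp only [Finset.mul_sum]
          rw [Finset.sum_comm' (t' := Finset.univ) (s' := fun _ ↦ Finset.univ) (by simp)]
          rw [Finset.sum_congr rfl fun l _ ↦ Finset.sum_comm, Finset.sum_comm]
          refine Finset.sum_congr rfl fun σ _ ↦ ?_
          rw [overlap, sq, Finset.sum_mul_sum, Finset.sum_comm]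
          exact Finset.sum_congr rfl fun k _ ↦ Finset.sum_congr rfl fun l _ ↦ by ring
      _ = N * (b + b / (N - 1)) - b / (N - 1) * ((∑ k, u k) * ∑ l, u l) := by
          simp only [hW, mul_sub, Finset.sum_sub_distrib, mul_ite, mul_zero, Finset.sum_ite_eq,
            Finset.mem_univ, if_true, huu, one_mul, Finset.sum_const, Finset.card_univ,
            nsmul_eq_mul, ← hN, ← Finset.sum_mul, ← Finset.mul_sum]
          ring
      _ = _ := by
          have : ∑ k, u k = 0 := sum_labelSign hP
          rw [this]; ring
  rw [h1]
  have h2 : b / (N - 1) ≤ b := div_le_self hb (by linarith)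
  nlinarith

/-- Chebyshev's inequality with the second moment `2N`. -/
lemma card_large_overlap_le {P : V → Fin 2} (hP : P ∈ balancedLabellings V 2)
    (hV : 2 ≤ Fintype.card V) :
    (((balancedFinset V).filter fun σ ↦ Fintype.card V / 100 < |overlap σ P|).card : ℝ)
      ≤ 20000 / Fintype.card V * (balancedFinset V).card := by
  set N : ℝ := (Fintype.card V : ℝ) with hN
  have hN2 : 2 ≤ N := by rw [hN]; exact_mod_cast hV
  have h : (((balancedFinset V).filter fun σ ↦ N / 100 < |overlap σ P|).card : ℝ)
      * (N / 100) ^ 2 ≤ 2 * N * (balancedFinset V).card := by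
    refine le_trans ?_ (sum_overlap_sq hP hV)
    rw [← nsmul_eq_mul]
    refine le_trans (Finset.card_nsmul_le_sum _ (fun σ ↦ overlap σ P ^ 2) _ fun σ hσ ↦ ?_)
      (Finset.sum_le_sum_of_subset_of_nonneg (Finset.filter_subset _ _) fun _ _ _ ↦ sq_nonneg _)
    rw [← sq_abs (overlap σ P)]
    exact pow_le_pow_left₀ (by positivity) (Finset.mem_filter.1 hσ).2.le 2
  rw [div_mul_eq_mul_div, le_div_iff₀ (by linarith)]
  have : 0 < N := by linarith
  refine le_of_mul_le_mul_right ?_ this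
  nlinarith

end Labellings

/-! ### Recovery with high probability -/

/-- Fubini in the second variable: slices over `B` are bounded by 1, all others by `η`. -/
lemma measureReal_prod_le_add {α β : Type*} [Finite α] [Finite β] [MeasurableSpace α]
    [MeasurableSpace β] [MeasurableSingletonClass α] [MeasurableSingletonClass β]
    (μ : Measure α) (ν : Measure β) [IsProbabilityMeasure μ] [IsProbabilityMeasure ν]
    (E : Set (α × β)) (B : Set β) {η : ℝ} (hη : 0 ≤ η)
    (h : ∀ y ∉ B, μ.real {x | (x, y) ∈ E} ≤ η) :
    (μ.prod ν).real E ≤ η + ν.real B := by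
  have hE : MeasurableSet E := E.toFinite.measurableSet
  have hB : MeasurableSet B := B.toFinite.measurableSet
  have key : μ.prod ν E ≤ ENNReal.ofReal η + ν B := by
    rw [Measure.prod_apply_symm hE]
    calc _ ≤ ∫⁻ y, (ENNReal.ofReal η + B.indicator 1 y) ∂ν := by
          refine lintegral_mono fun y ↦ ?_
          by_cases hy : y ∈ B
          · rw [Set.indicator_of_mem hy]
            exact prob_le_one.trans le_add_self
          · rw [Set.indicator_of_notMem hy, add_zero]
            exact (ENNReal.le_ofReal_iff_toReal_le (measure_ne_top _ _) hη).2 (h y hy)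
      _ = _ := by
          rw [lintegral_add_left measurable_const, lintegral_const, measure_univ, mul_one,
            lintegral_indicator_one hB]
  rw [measureReal_def, measureReal_def]
  refine (ENNReal.toReal_mono (by simp) key).trans ?_
  rw [ENNReal.toReal_add (by simp) (by simp), ENNReal.toReal_ofReal hη]

lemma edgeProb_mk {V : Type*} (P : V → Fin 2) (p q : unitInterval) (i k : V) :
    (edgeProb P p q s(i, k) : ℝ)
      = ((p : ℝ) + q) / 2 + ((p : ℝ) - q) / 2 * (labelSign (P i) * labelSign (P k)) := by
  rw [labelSign_mul, edgeProb]
  simp only [Sym2.map_mk, Sym2.mk_isDiag_iff, eq_comm (a := P k)]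
  split_ifs <;> ring

lemma edgeProb_le {V : Type*} (P : V → Fin 2) {p q : unitInterval} (h : (q : ℝ) ≤ p) (e : Sym2 V) :
    (edgeProb P p q e : ℝ) ≤ p := by
  rw [edgeProb]; split_ifs
  · exact le_rfl
  · exact h

section Model

variable {V : Type*} [Fintype V]

instance : MeasurableSingletonClass (SimpleGraph V) where
  measurableSet_singleton G := by
    have h : ({G} : Set (SimpleGraph V)) = SimpleGraph.edgeSet ⁻¹' {G.edgeSet} := by
      ext H; simp
    rw [h]
    exact SimpleGraph.measurable_edgeSet (measurableSet_singleton _)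

lemma measurable_fromEdgeSet_coins :
    Measurable fun x : Sym2 V → Bool ↦ SimpleGraph.fromEdgeSet {e | x e = true} :=
  Measurable.of_discrete

instance {k : ℕ} (P : V → Fin k) (p q : unitInterval) :
    IsProbabilityMeasure (stochasticBlockModel P p q) :=
  Measure.isProbabilityMeasure_map measurable_fromEdgeSet_coins.aemeasurable

lemma measureReal_not_recovers_le {P σ : V → Fin 2} (hP : P ∈ balancedLabellings V 2)
    (hσ : σ ∈ balancedLabellings V 2) {p q : unitInterval} {L : ℝ} (hp : 0 < (p : ℝ))
    (hqp : (q : ℝ) ≤ p) (hL : 1 ≤ L) (hN : 25600 * L ≤ p * Fintype.card V)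
    (hD : |overlap σ P| ≤ Fintype.card V / 100)
    (hR : 24 * √(p * Fintype.card V * L) ≤ (p - q) * Fintype.card V)
    (hS : 10000 * L * p ≤ ((p : ℝ) - q) ^ 2 * |overlap σ P|) :
    (stochasticBlockModel P p q).real
      {G | ¬ DER.Recovers (DER.step (G.adjMatrix ℝ) 1 (cells σ)) P}
      ≤ 10 * Fintype.card V * Real.exp (-(3 * L)) := by
  rw [stochasticBlockModel, map_measureReal_apply measurable_fromEdgeSet_coins
    (Set.toFinite _).measurableSet]
  refine (measureReal_mono fun x hx ↦ ?_).trans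
    (measureReal_not_isTypical_le (edgeProb P p q) (edgeProb_le P hqp)
      (fun k ↦ labelSign (σ k)) (fun k ↦ (abs_labelSign _).le)
      (fun k ↦ labelSign (P k)) (fun k ↦ (abs_labelSign _).le) hL p.2.2 (by linarith))
  intro hA
  refine hx ?_
  suffices h : DER.Recovers (DER.step (coinMatrix x) 1 (cells σ)) P by
    rw [coinMatrix] at h
    convert h
  have hM : ∀ i k, meanMatrix (edgeProb P p q) i k = if i = k then 0 else
      ((p : ℝ) + q) / 2 + ((p : ℝ) - q) / 2 * (labelSign (P i) * labelSign (P k)) := by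
    intro i k
    rw [meanMatrix, edgeProb_mk]
  have h01 : ∀ i k, 0 ≤ coinMatrix x i k ∧ coinMatrix x i k ≤ 1 := by
    intro j k
    rw [coinMatrix_apply, coin]
    split_ifs <;> norm_num
  have hsymm : ∀ i k, coinMatrix x i k = coinMatrix x k i := fun i k ↦ by
    simp only [coinMatrix_apply, eq_comm (a := i), Sym2.eq_swap (a := i)]
  have hdiag : ∀ i, coinMatrix x i i = 0 := fun i ↦ by simp [coinMatrix_apply]
  -- The overlap may be negative; its sign is recorded as a label and later fixes the order of the
  -- recovered cells.
  obtain ⟨a, ha⟩ : ∃ a : Fin 2, labelSign a * overlap σ P = |overlap σ P| := by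
    rcases le_total 0 (overlap σ P) with h | h
    · exact ⟨0, by simp [labelSign, abs_of_nonneg h]⟩
    · exact ⟨1, by simp [labelSign, abs_of_nonpos h]⟩
  rw [overlap] at hD hS ha
  have hs : ∀ i, |labelSign (σ i)| = 1 := fun _ ↦ abs_labelSign _
  have hu : ∀ i, |labelSign (P i)| = 1 := fun _ ↦ abs_labelSign _
  refine recovers_of_score (A := coinMatrix x) (a := a) hsymm (fun l j ↦ ?_) fun i ↦ ?_
  · have h := cellDegree_near hp p.2.2 q.2.1 hqp hL hs hu (sum_labelSign hσ)
      (sum_labelSign hP) hM hA hN hD (abs_labelSign l) j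
    have hq : 0 ≤ (q : ℝ) * Fintype.card V := mul_nonneg q.2.1 (by positivity)
    nlinarith [(abs_le.1 h).1]
  · exact score_pos hp p.2.2 q.2.1 hqp hL hs hu (sum_labelSign hσ) (sum_labelSign hP) hM hdiag
      (fun i k ↦ (h01 i k).1) (fun i k ↦ (h01 i k).2) hA hN hD hR hS (abs_labelSign a) ha i

lemma measureReal_atypical_overlap_le {P : V → Fin 2} (hP : P ∈ balancedLabellings V 2)
    (hV : 2 ≤ Fintype.card V) {T : ℝ} (hT : 0 ≤ T) :
    (uniformOn (balancedLabellings V 2)).real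
      {σ | σ ∉ balancedLabellings V 2 ∨ |overlap σ P| < T ∨ Fintype.card V / 100 < |overlap σ P|}
      ≤ (T / 2 + 1) * (3 / √(Fintype.card V)) + 20000 / Fintype.card V := by
  obtain ⟨n, hn⟩ : ∃ n, Fintype.card V = 2 * n := ⟨_, (hP 0).symm⟩
  have h1 := card_small_overlap_le hP hn (by omega) hT
  have h2 := card_large_overlap_le hP hV
  have hc : (0 : ℝ) < (balancedFinset V).card := by
    exact_mod_cast Finset.card_pos.2 ⟨P, mem_balancedFinset.2 hP⟩
  have hB : balancedLabellings V 2 = (balancedFinset V : Set (V → Fin 2)) := by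
    ext; simp [mem_balancedFinset]
  set F : Finset (V → Fin 2) := Finset.univ.filter fun σ ↦
    σ ∉ balancedLabellings V 2 ∨ |overlap σ P| < T ∨ Fintype.card V / 100 < |overlap σ P| with hF
  have hset : {σ | σ ∉ balancedLabellings V 2 ∨ |overlap σ P| < T ∨
      Fintype.card V / 100 < |overlap σ P|} = (F : Set (V → Fin 2)) := by
    ext; simp [hF]
  rw [hset, measureReal_def, hB, uniformOn_apply_finset, ENNReal.toReal_div, ENNReal.toReal_natCast,
    ENNReal.toReal_natCast, div_le_iff₀ hc]
  have h3 : (balancedFinset V ∩ F).card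
      ≤ ((balancedFinset V).filter fun σ ↦ |overlap σ P| < T).card
        + ((balancedFinset V).filter fun σ ↦ Fintype.card V / 100 < |overlap σ P|).card := by
    refine (Finset.card_le_card fun σ hσ ↦ ?_).trans (Finset.card_union_le _ _)
    obtain ⟨h4, h5⟩ := Finset.mem_inter.1 hσ
    have h6 := (Finset.mem_filter.1 h5).2
    simp only [Finset.mem_union, Finset.mem_filter, h4, true_and]
    exact h6.resolve_left (not_not.2 (mem_balancedFinset.1 h4))
  have h3' : ((balancedFinset V ∩ F).card : ℝ) ≤ _ := Nat.cast_le.2 h3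
  push_cast at h3'
  have hn0 : (0 : ℝ) < n := by
    have : 0 < n := by omega
    exact_mod_cast this
  -- As `N = 2n`, this is `2√2 ≤ 3`.
  have h7 : 2 / √(n : ℝ) ≤ 3 / √(Fintype.card V : ℝ) := by
    have h8 : (Fintype.card V : ℝ) = 2 * n := by exact_mod_cast hn
    rw [h8, Real.sqrt_mul zero_le_two, div_le_div_iff₀ (by positivity) (by positivity), ← mul_assoc]
    have : √2 ≤ 3 / 2 := Real.sqrt_le_iff.2 ⟨by norm_num, by norm_num⟩
    nlinarith [Real.sqrt_nonneg (n : ℝ)]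
  calc _ ≤ _ := h3'.trans (add_le_add h1 h2)
    _ ≤ (T / 2 + 1) * (3 / √(Fintype.card V)) * (balancedFinset V).card
        + 20000 / Fintype.card V * (balancedFinset V).card := by gcongr
    _ = _ := by ring

end Model

/-- A rate for the probability of recovery. -/
def recoveryRate (ε : ℝ) (N : ℕ) : ℝ :=
  1 - (2 * (N : ℝ) ^ (-(ε / 2)) + 3 * (N : ℝ) ^ (-(1 / 2) : ℝ) + 20010 * (N : ℝ) ^ (-1 : ℝ))

lemma tendsto_recoveryRate {ε : ℝ} (hε : 0 < ε) : Tendsto (recoveryRate ε) atTop (𝓝 1) := by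
  have h : ∀ a : ℝ, 0 < a → Tendsto (fun N : ℕ ↦ (N : ℝ) ^ (-a)) atTop (𝓝 0) := fun a ha ↦
    (tendsto_rpow_neg_atTop ha).comp tendsto_natCast_atTop_atTop
  have := ((((h (ε / 2) (by linarith)).const_mul 2).add
    ((h (1 / 2) (by norm_num)).const_mul 3)).add ((h 1 one_pos).const_mul 20010)).const_sub 1
  simp only [mul_zero, add_zero, sub_zero] at this
  exact this

lemma eventually_large {ε : ℝ} (hε : 0 < ε) : ∀ᶠ N : ℕ in atTop,
    2 ≤ N ∧ 1 ≤ Real.log N ∧ 10000 ≤ (N : ℝ) ^ (ε / 2) ∧ 25600 ≤ (N : ℝ) ^ (1 / 2 + ε) := by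
  have hpow : ∀ a : ℝ, 0 < a → Tendsto (fun N : ℕ ↦ (N : ℝ) ^ a) atTop atTop := fun a ha ↦
    (tendsto_rpow_atTop ha).comp tendsto_natCast_atTop_atTop
  filter_upwards [eventually_ge_atTop 2,
    (Real.tendsto_log_atTop.comp tendsto_natCast_atTop_atTop).eventually_ge_atTop 1,
    (hpow (ε / 2) (by linarith)).eventually_ge_atTop 10000,
    (hpow (1 / 2 + ε) (by linarith)).eventually_ge_atTop 25600] with N h1 h2 h3 h4
  exact ⟨h1, h2, h3, h4⟩

lemma recoveryRate_le {ε : ℝ} {N : ℕ} (hN : 2 ≤ N) (hL : 1 ≤ Real.log N)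
    (h1 : 10000 ≤ (N : ℝ) ^ (ε / 2)) (h2 : 25600 ≤ (N : ℝ) ^ (1 / 2 + ε)) {P : Fin N → Fin 2}
    (hP : P ∈ balancedLabellings (Fin N) 2) {p q : unitInterval}
    (hp : (N : ℝ) ^ (-(1 / 2 : ℝ) + ε) ≤ p)
    (hpq : √((p : ℝ) * (N : ℝ) ^ (-(1 / 2 : ℝ) + ε) * Real.log N) ≤ (p : ℝ) - q) :
    recoveryRate ε N ≤ ((stochasticBlockModel P p q).prod
      (uniformOn (balancedLabellings (Fin N) 2))).real
        {x | DER.Recovers (DER.step (x.1.adjMatrix ℝ) 1 (cells x.2)) P} := by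
  have hN0 : (0 : ℝ) < N := by positivity
  set L := Real.log N with hLdef
  set r := (N : ℝ) ^ (-(1 / 2 : ℝ) + ε)
  have hr0 : 0 < r := Real.rpow_pos_of_pos hN0 _
  have hp0 : 0 < (p : ℝ) := hr0.trans_le hp
  have hqp : 0 ≤ (p : ℝ) - q := (Real.sqrt_nonneg _).trans hpq
  have hsq : p * r * L ≤ ((p : ℝ) - q) ^ 2 := (Real.sqrt_le_left hqp).1 hpq
  -- Since `p - q ≤ p`, the gap condition also forces a density bound, with the logarithmic factor
  -- needed for `pN ≥ 25600 L`.
  have hrp : r * L ≤ p := by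
    refine le_of_mul_le_mul_left ?_ hp0
    calc (p : ℝ) * (r * L) = p * r * L := by ring
      _ ≤ ((p : ℝ) - q) ^ 2 := hsq
      _ ≤ (p : ℝ) ^ 2 := by gcongr; linarith [q.2.1]
      _ = p * p := sq _
  have hrN : r * N = (N : ℝ) ^ (1 / 2 + ε) := by
    rw [← Real.rpow_add_one hN0.ne']; ring_nf
  -- Half of the exponent `ε` is spent on making `|overlap| < T` unlikely, with probability of order
  -- `N^(-ε/2)`; the other half leaves `rT = N^(ε/2)` to beat the constant 10000.
  set T := (N : ℝ) ^ (1 / 2 - ε / 2)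
  have hT : 0 ≤ T := (Real.rpow_pos_of_pos hN0 _).le
  have hrT : r * T = (N : ℝ) ^ (ε / 2) := by
    rw [← Real.rpow_add hN0]; ring_nf
  have hcard : (Fintype.card (Fin N) : ℝ) = N := by simp
  have hprob : IsProbabilityMeasure (uniformOn (balancedLabellings (Fin N) 2)) :=
    isProbabilityMeasure_uniformOn (Set.toFinite _) ⟨P, hP⟩
  have hexp : 10 * N * Real.exp (-(3 * L)) ≤ 10 * (N : ℝ) ^ (-1 : ℝ) := by
    have e : Real.exp (-(3 * L)) = (N : ℝ) ^ (-3 : ℝ) := by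
      rw [Real.rpow_def_of_pos hN0, hLdef]; ring_nf
    rw [e, mul_assoc]
    gcongr
    calc (N : ℝ) * (N : ℝ) ^ (-3 : ℝ) = (N : ℝ) ^ (-2 : ℝ) := by
          rw [← Real.rpow_one_add' hN0.le (by norm_num)]; norm_num
      _ ≤ _ := Real.rpow_le_rpow_of_exponent_le (by exact_mod_cast (by omega : 1 ≤ N)) (by norm_num)
  set E : Set (SimpleGraph (Fin N) × (Fin N → Fin 2)) :=
    {x | DER.Recovers (DER.step (x.1.adjMatrix ℝ) 1 (cells x.2)) P}
  have hfail := measureReal_prod_le_add (stochasticBlockModel P p q)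
    (uniformOn (balancedLabellings (Fin N) 2)) Eᶜ
    {σ | σ ∉ balancedLabellings (Fin N) 2 ∨ |overlap σ P| < T ∨
      Fintype.card (Fin N) / 100 < |overlap σ P|}
    (η := 10 * N * Real.exp (-(3 * L))) (by positivity) (by
      intro σ hσ
      simp only [Set.mem_ofPred_eq, not_or, not_not, not_lt] at hσ
      obtain ⟨hσ, hσT, hσN⟩ := hσ
      have h := measureReal_not_recovers_le (L := L) hP hσ hp0 (by linarith) hL ?_ hσN ?_ ?_
      · rw [hcard] at h; exact h
      · rw [hcard]
        nlinarith
      · rw [hcard]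
        have h24 : (24 : ℝ) = √(24 ^ 2) := by rw [Real.sqrt_sq (by norm_num)]
        rw [h24, ← Real.sqrt_mul (by norm_num)]
        refine Real.sqrt_le_iff.2 ⟨by positivity, ?_⟩
        have hpos : 0 ≤ p * L * N := by positivity
        calc (24 : ℝ) ^ 2 * (p * N * L) ≤ 25600 * (p * L * N) := by linarith
          _ ≤ (r * N) * (p * L * N) := by rw [hrN]; gcongr
          _ = p * r * L * N ^ 2 := by ring
          _ ≤ ((p : ℝ) - q) ^ 2 * N ^ 2 := by gcongr
          _ = _ := by ring
      · calc 10000 * L * p ≤ r * T * (L * p) := by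
              rw [hrT, mul_assoc]; gcongr
          _ = p * r * L * T := by ring
          _ ≤ ((p : ℝ) - q) ^ 2 * |overlap σ P| := by gcongr)
  have hover := measureReal_atypical_overlap_le hP (by simpa using hN) hT
  have hcompl := probReal_compl_eq_one_sub (μ := (stochasticBlockModel P p q).prod
    (uniformOn (balancedLabellings (Fin N) 2))) E.toFinite.measurableSet
  rw [hcompl] at hfail
  rw [hcard] at hover hfail
  have e1 : 3 / √(N : ℝ) = 3 * (N : ℝ) ^ (-(1 / 2) : ℝ) := by
    rw [Real.sqrt_eq_rpow, Real.rpow_neg hN0.le, div_eq_mul_inv]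
  have e2 : T * (N : ℝ) ^ (-(1 / 2) : ℝ) = (N : ℝ) ^ (-(ε / 2)) := by
    rw [← Real.rpow_add hN0]; ring_nf
  have e3 : 20000 / (N : ℝ) = 20000 * (N : ℝ) ^ (-1 : ℝ) := by
    rw [Real.rpow_neg_one, div_eq_mul_inv]
  have e4 : (T / 2 + 1) * (3 / √(N : ℝ)) ≤ 2 * (N : ℝ) ^ (-(ε / 2)) + 3 * (N : ℝ) ^ (-(1 / 2) : ℝ) := by
    rw [e1, ← e2]
    have : 0 ≤ T * (N : ℝ) ^ (-(1 / 2) : ℝ) := by positivity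
    linarith
  rw [recoveryRate]
  linarith

end

theorem theorem5p1 (ε : ℝ) (hε : 0 < ε) :
    ∃ C : ℝ, 0 < C ∧ ∃ c : ℝ, 0 < c ∧ ∃ φ : ℕ → ℝ, Tendsto φ atTop (𝓝 1) ∧
      ∀ (N : ℕ) (P : Fin N → Fin 2), P ∈ balancedLabellings (Fin N) 2 →
        ∀ p q : unitInterval,
          C * (N : ℝ) ^ (-(1 / 2 : ℝ) + ε) ≤ (p : ℝ) →
          c * Real.sqrt ((p : ℝ) * (N : ℝ) ^ (-(1 / 2 : ℝ) + ε) * Real.log (N : ℝ))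
            ≤ (p : ℝ) - (q : ℝ) →
          φ N ≤ ((stochasticBlockModel P p q).prod
              (uniformOn (balancedLabellings (Fin N) 2))).real
            {x : SimpleGraph (Fin N) × (Fin N → Fin 2) |
              DER.Recovers (DER.step (x.1.adjMatrix ℝ) 1 (cells x.2)) P} := by
  obtain ⟨N₀, hN₀⟩ := eventually_atTop.1 (eventually_large hε)
  -- Powers of `N` absorb every constant once `N ≥ N₀`, so `C = c = 1` works; below `N₀` the trivial
  -- bound 0 is used.
  refine ⟨1, one_pos, 1, one_pos, fun N ↦ if N₀ ≤ N then recoveryRate ε N else 0,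
    (tendsto_recoveryRate hε).congr' ?_, ?_⟩
  · filter_upwards [eventually_ge_atTop N₀] with N hN
    rw [if_pos hN]
  · intro N P hP p q hp hpq
    rw [one_mul] at hp hpq
    beta_reduce
    split_ifs with hN
    · obtain ⟨h1, h2, h3, h4⟩ := hN₀ N hN
      exact recoveryRate_le h1 h2 h3 h4 hP hp hpq
    · exact measureReal_nonneg
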